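/- **Setting.** Let $m_{sr},m_{rd}\ge 1$ be integers and let $\flat_{sr}>0$, $\Omega_{sr}\ge 0$, $\nu,w_{er},w_{\min},h_0,l>0$, $\chi,\mu\in(0,1)$, $\rho,\varepsilon\in[0,1)$ not both zero, $\eta_s,\mathcal P_{th}>0$, $\sigma_r,\sigma_{rb},\sigma_d>0$ and $\gamma_S>0$. Put $$\alpha_{sr}=\frac{1}{2\flat_{sr}}\Big(\frac{2\flat_{sr}m_{sr}}{2\flat_{sr}m_{sr}+\Omega_{sr}}\Big)^{m_{sr}},\quad \beta_{sr}=\frac1{2\flat_{sr}},\quad \delta_{sr}=\frac{\Omega_{sr}}{2\flat_{sr}(2\flat_{sr}m_{sr}+\Omega_{sr})},\quad \bar\beta=\beta_{sr}-\delta_{sr},\quad \zeta(k)=\frac{(-1)^k(1-m_{sr})_k\,\delta_{sr}^k}{(k!)^2},$$ $w_{\max}=\sqrt{w_{\min}^2+2w_{er}w_{\min}}$. Let $g_{sr},g_{rd}$ be complex and $w_{sr},w_{rd}$ real random variables such that $|g_{sr}|^2,|g_{rd}|^2,w_{sr},w_{rd}$ are independent, with densities - $\alpha_{sr}\sum_{k=0}^{m_{sr}-1}\zeta(k)x^ke^{-\bar\beta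 x}$ on $(0,\infty)$ for $|g_{sr}|^2$ (shadowed-Rician fading), - $\frac{m_{rd}^{m_{rd}}}{\Gamma(m_{rd})}x^{m_{rd}-1}e^{-m_{rd}x}$ on $(0,\infty)$ for $|g_{rd}|^2$ (Nakagami fading), - $\frac{w}{w_{er}w_{\min}}$ on $[w_{\min},w_{\max}]$ for $w_{sr}$, and $\frac{2v}{l^2}$ on $[h_0,\sqrt{h_0^2+l^2}]$ for $w_{rd}$. Put $\chi_{\rho,\varepsilon}=\chi\big(\frac{2\rho}{1-\rho}+\varepsilon\big)$, $\mu_\varepsilon=\mu\big(\sigma_r^2+\frac{\sigma_{rb}^2}{1-\varepsilon}\big)$, $\mu'=\frac{\mu}{1-\mu}$, $\mathcal A=\chi_{\rho,\varepsilon}\eta_s(\mu-(1-\mu)\gamma_S)$, $\mathcal B=\mu_\varepsilon\chi_{\rho,\varepsilon}\gamma_S$, $\mathcal P_{\mathcal A,\mathcal B}=\frac{\mathcal P_{th}\mathcal A}{\eta_s}-\mathcal B$, $c=m_{rd}\sigma_d^2\gamma_S\eta_s/\mathcal P_{th}$. The signal-to-noise ratio at the ground user when the energy harvester is saturated is $$\Lambda_{2}=\frac{\mu\chi_{\rho,\varepsilon}\mathcal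 P_{th}\eta_s|g_{sr}|^2w_{sr}^{-2}|g_{rd}|^2w_{rd}^{-\nu}}{\mu_\varepsilon\chi_{\rho,\varepsilon}\mathcal P_{th}|g_{rd}|^2w_{rd}^{-\nu}+(1-\mu)\chi_{\rho,\varepsilon}\eta_s\mathcal P_{th}|g_{sr}|^2w_{sr}^{-2}|g_{rd}|^2w_{rd}^{-\nu}+\eta_s|g_{sr}|^2w_{sr}^{-2}\sigma_d^2},$$ and $\mathcal P_2(\gamma_S)=\Pr\big[\Lambda_{2}>\gamma_S,\ \eta_s|g_{sr}|^2w_{sr}^{-2}>\mathcal P_{th}\big]$. Let $\Delta_\Gamma(a,x,y)=\Gamma(a,x)-\Gamma(a,y)$ with the upper incomplete Gamma function, $\mathbb W_{\kappa,\lambda}$ the Whittaker function, and $G^{2,1}_{1,3}$ the Meijer $G$-function. **Theorem.** $$\mathcal P_2(\gamma_S)=\begin{cases}\Psi_2,&\gamma_S<\mu'\text{ and }\mathcal P_{th}>\frac{\mathcal B}{\mathcal A}\eta_s,\\ \Psi_3,&\gamma_S<\mu'\text{ and }\mathcal P_{th}\le\frac{\mathcal B}{\mathcal A}\eta_s,\\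 0,&\gamma_S\ge\mu',\end{cases}$$ where $$\Psi_2=\frac{2\alpha_{sr}\,c^{-2/\nu}}{l^2w_{er}w_{\min}\nu}\sum_{k=0}^{m_{sr}-1}\zeta(k)\sum_{n=0}^{m_{rd}-1}\frac1{n!}\sum_{k_1=0}^{k+n}\binom{k+n}{k_1}\sum_{k_2=0}^\infty\frac{(-1)^{k_2}}{k_2!}\,\bar\beta^{\frac{n-k_1+k_2}2-1}\,\frac{\mathcal P_{\mathcal A,\mathcal B}^{\frac{-n+k_1-k_2}2}\,\mathcal B^{k+n-k_1+k_2}}{\mathcal A^{k+1+\frac{n-k_1+k_2-2}2-\frac2\nu}}\,\Delta_\Gamma\Big(n+k_2+\tfrac2\nu,\tfrac{c\,h_0^\nu}{\mathcal A},\tfrac{c\,(h_0^2+l^2)^{\nu/2}}{\mathcal A}\Big)\,\mathbb I_1,$$ $$\mathbb I_1=\int_{w_{\min}}^{w_{\max}}w^{2k+n-k_1+k_2+1}\exp\Big(-\tfrac{\bar\beta w^2}{\mathcal A}\big(\mathcal B+\tfrac{\mathcal P_{\mathcal A,\mathcal B}}2\big)\Big)\mathbb W_{\frac{-n+k_1-k_2}2,\frac{n-k_1+k_2-1}2}\Big(\tfrac{\bar\beta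 w^2\mathcal P_{\mathcal A,\mathcal B}}{\mathcal A}\Big)dw,$$ and, with $\varsigma_2=\frac{n+k_1+2k_2+1}2$ and $\varsigma_3=\frac{-n+k_1+1}2$, $$\Psi_3=\frac{2\alpha_{sr}}{l^2w_{er}w_{\min}\nu}\sum_{k=0}^{m_{sr}-1}\zeta(k)\sum_{n=0}^{m_{rd}-1}\sum_{k_1=0}^{k+n}\binom{k+n}{k_1}\sum_{k_2=0}^\infty\frac{(-1)^{k_2}}{n!\,k_2!}\,\frac{\bar\beta^{\frac{n-k_1-1}2}\mathcal B^{\frac{2k+n-k_1+1}2}}{\mathcal A^{k+n+1+k_2}}\,c^{\frac{n+k_1+1}2+k_2}\,\mathbb I_2,$$ $$\mathbb I_2=\int_{w_{\min}}^{w_{\max}}\Big[(h_0^2+l^2)^{\frac{\nu\varsigma_2}2+1}\,\mathcal G\big((h_0^2+l^2)^{\nu/2}\big)-h_0^{\nu\varsigma_2+2}\,\mathcal G\big(h_0^\nu\big)\Big]w^{2k+n-k_1+2}\exp\Big(-\tfrac{\mathcal B\bar\beta w^2}{\mathcal A}\Big)dw,$$ $$\mathcal G(T)=G^{2,1}_{1,3}\left[\frac{c\,T\,\mathcal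 B\bar\beta w^2}{\mathcal A^2}\ \middle|\ {1-\varsigma_2-\frac2\nu\atop \varsigma_3,\,-\varsigma_3,\,-\varsigma_2-\frac2\nu}\right].$$ In the respective cases the integrands of $\mathbb I_1$ and $\mathbb I_2$ are integrable and the series over $k_2$ converge absolutely. -/

import Mathlib

open MeasureTheory ProbabilityTheory Set

noncomputable section

/-! ### Special functions -/

/-- Upper incomplete Gamma function `Γ(a, x) = ∫_x^∞ t^(a-1) e^(-t) dt`, for `x > 0`. -/
def upperGamma (a x : ℝ) : ℝ :=
  ∫ t in Ioi x, t ^ (a - 1) * Real.exp (-t)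

/-- `Δ_Γ(a, b, c) = Γ(a, b) - Γ(a, c)`. -/
def deltaGamma (a b c : ℝ) : ℝ :=
  upperGamma a b - upperGamma a c

/-- Whittaker function `W_{κ,μ}(z)` for `z > 0` and real `κ, μ` with `κ < |μ| + 1/2`, through its
Laplace integral
`W_{κ,μ}(z) = e^(-z/2) z^(μ+1/2) / Γ(μ-κ+1/2) * ∫_0^∞ e^(-zt) t^(μ-κ-1/2) (1+t)^(μ+κ-1/2) dt`.
`W` is even in `μ`, and the integral is taken at `|μ|`, where its range of validity is largest. -/
def whittakerW (κ μ z : ℝ) : ℝ :=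
  Real.exp (-z / 2) * z ^ (|μ| + 1 / 2) / Real.Gamma (|μ| - κ + 1 / 2) *
    ∫ t in Ioi (0 : ℝ),
      Real.exp (-(z * t)) * t ^ (|μ| - κ - 1 / 2) * (1 + t) ^ (|μ| + κ - 1 / 2)

/-- The Mellin-Barnes integrand of the Meijer function `G^{m,n}_{p,q}(x)`. The upper parameters
are `a` (the first `n`) followed by `a'` (the other `p - n`), the lower ones are
`b` (the first `m`) followed by `b'` (the other `q - m`). -/
def meijerIntegrand {m n p' q' : ℕ} (a : Fin n → ℝ) (a' : Fin p' → ℝ) (b : Fin m → ℝ)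
    (b' : Fin q' → ℝ) (x : ℝ) (s : ℂ) : ℂ :=
  (∏ j, Complex.Gamma (b j - s)) * (∏ j, Complex.Gamma (1 - a j + s)) /
      ((∏ j, Complex.Gamma (1 - b' j + s)) * (∏ j, Complex.Gamma (a' j - s))) *
    (x : ℂ) ^ s

open Classical in
/-- Meijer function `G^{m,n}_{p,q}(x)` with real parameters at `x > 0`, as the Mellin-Barnes
integral `(2πi)⁻¹ ∫ ds` upwards along a vertical line `Re s = c` that has the poles of all
`Γ(b j - s)` on its right and the poles of all `Γ(1 - a j + s)` on its left. This covers the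
parameters for which such a line exists and `p + q < 2 (m + n)`; then the integral converges
absolutely, does not depend on `c`, and is real. -/
def meijerG {m n p' q' : ℕ} (a : Fin n → ℝ) (a' : Fin p' → ℝ) (b : Fin m → ℝ)
    (b' : Fin q' → ℝ) (x : ℝ) : ℝ :=
  if h : ∃ c : ℝ, (∀ j, a j - 1 < c) ∧ (∀ j, c < b j) then
    ((1 / (2 * (Real.pi : ℂ))) *
      ∫ y : ℝ, meijerIntegrand a a' b b' x ((h.choose : ℂ) + y * Complex.I)).re
  else 0

/-- `G^{2,1}_{1,3}[x | a ; b₁, b₂, b₃]`. -/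
def meijerG2113 (a b₁ b₂ b₃ x : ℝ) : ℝ :=
  meijerG ![a] ![] ![b₁, b₂] ![b₃] x

/-! ### The network -/

/-- Parameters of the satellite-to-ground network.
`m_sr, b_sr, Ω_sr`: shadowed-Rician fading (severity, half the multipath power, line-of-sight
power); `m_rd`: Nakagami fading severity; `ν`: path loss exponent of the relay-to-user link;
`w_er`: distance from the Earth's centre to the relay; `w_min`: minimum satellite-relay distance;
`h₀`: altitude of the relay; `l`: radius of the disc of ground users; `χ`: energy conversion
efficiency; `ρ`, `ε`: time and power splitting factors; `μ`: spectrum sharing factor;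
`η`: the scaled transmit power of the satellite; `Pth`: saturation threshold power;
`σr, σrb, σd`: standard deviations of the noises at the relay, of the conversion to baseband
and at the user; `γ`: the threshold. -/
structure S2GParams where
  m_sr : ℕ
  m_rd : ℕ
  b_sr : ℝ
  Ω_sr : ℝ
  ν : ℝ
  w_er : ℝ
  w_min : ℝ
  h₀ : ℝ
  l : ℝ
  χ : ℝ
  ρ : ℝ
  ε : ℝ
  μ : ℝ
  η : ℝ
  Pth : ℝ
  σr : ℝ
  σrb : ℝ
  σd : ℝ
  γ : ℝ
  m_sr_pos : 0 < m_sr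
  m_rd_pos : 0 < m_rd
  b_sr_pos : 0 < b_sr
  Ω_sr_nonneg : 0 ≤ Ω_sr
  ν_pos : 0 < ν
  w_er_pos : 0 < w_er
  w_min_pos : 0 < w_min
  h₀_pos : 0 < h₀
  l_pos : 0 < l
  χ_mem : χ ∈ Ioo (0 : ℝ) 1
  ρ_mem : ρ ∈ Ico (0 : ℝ) 1
  ε_mem : ε ∈ Ico (0 : ℝ) 1
  /-- some energy is harvested -/
  ρ_ε : 0 < ρ ∨ 0 < ε
  μ_mem : μ ∈ Ioo (0 : ℝ) 1
  η_pos : 0 < η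
  Pth_pos : 0 < Pth
  σr_pos : 0 < σr
  σrb_pos : 0 < σrb
  σd_pos : 0 < σd
  γ_pos : 0 < γ

namespace S2GParams

variable (p : S2GParams)

/-! Shadowed-Rician fading -/

def α : ℝ :=
  (2 * p.b_sr * p.m_sr / (2 * p.b_sr * p.m_sr + p.Ω_sr)) ^ p.m_sr / (2 * p.b_sr)

def β : ℝ := 1 / (2 * p.b_sr)

def δ : ℝ := p.Ω_sr / ((2 * p.b_sr) * (2 * p.b_sr * p.m_sr + p.Ω_sr))

/-- `β̄ = β - δ`. -/
def βbar : ℝ := p.β - p.δ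

/-- `ζ(k) = (-1)^k (1 - m_sr)_k δ^k / (k!)^2`. -/
def ζ (k : ℕ) : ℝ :=
  (-1) ^ k * (ascPochhammer ℝ k).eval (1 - (p.m_sr : ℝ)) * p.δ ^ k / (k.factorial : ℝ) ^ 2

/-- Density of `|g_sr|²` on `(0, ∞)`. -/
def pdfGsr (x : ℝ) : ℝ :=
  p.α * ∑ k ∈ Finset.range p.m_sr, p.ζ k * x ^ k * Real.exp (-((p.β - p.δ) * x))

/-- Density of `|g_rd|²` on `(0, ∞)`. -/
def pdfGrd (x : ℝ) : ℝ :=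
  (p.m_rd : ℝ) ^ p.m_rd / Real.Gamma p.m_rd * x ^ (p.m_rd - 1) * Real.exp (-(p.m_rd * x))

/-- Maximum satellite-relay distance. -/
def w_max : ℝ := Real.sqrt (p.w_min ^ 2 + 2 * p.w_er * p.w_min)

/-- Density of `w_sr` on `[w_min, w_max]`. -/
def pdfWsr (w : ℝ) : ℝ := w / (p.w_er * p.w_min)

/-- Maximum relay-user distance. -/
def v_max : ℝ := Real.sqrt (p.h₀ ^ 2 + p.l ^ 2)

/-- Density of `w_rd` on `[h₀, √(h₀² + l²)]`. -/
def pdfWrd (v : ℝ) : ℝ := 2 * v / p.l ^ 2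

/-! Derived constants -/

/-- `χ_{ρ,ε} = χ (2ρ/(1-ρ) + ε)`. -/
def χρε : ℝ := p.χ * (2 * p.ρ / (1 - p.ρ) + p.ε)

/-- `μ_ε = μ (σ_r² + σ_rb²/(1-ε))`. -/
def με : ℝ := p.μ * (p.σr ^ 2 + p.σrb ^ 2 / (1 - p.ε))

/-- `μ' = μ / (1-μ)`. -/
def μ' : ℝ := p.μ / (1 - p.μ)

def A : ℝ := p.χρε * p.η * (p.μ - (1 - p.μ) * p.γ)

def B : ℝ := p.με * p.χρε * p.γ

/-- `P_{A,B} = P_th A / η - B`. -/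
def PAB : ℝ := p.Pth * p.A / p.η - p.B

/-! Signal-to-noise ratio in saturation -/

/-- The signal-to-noise ratio `Λ_{D,2}` at the ground user when the energy harvester is saturated,
as a function of `X = |g_sr|²`, `Y = |g_rd|²`, `w = w_sr` and `v = w_rd`. -/
def snr₂ (X Y w v : ℝ) : ℝ :=
  p.μ * p.χρε * p.Pth * p.η * X * w ^ (-2 : ℝ) * Y * v ^ (-p.ν) /
    (p.με * p.χρε * p.Pth * Y * v ^ (-p.ν) +
      (1 - p.μ) * p.χρε * p.η * p.Pth * X * w ^ (-2 : ℝ) * Y * v ^ (-p.ν) +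
      p.η * X * w ^ (-2 : ℝ) * p.σd ^ 2)

end S2GParams

/-- The law of `X` has density `f` on `S` and does not charge the complement of `S`. -/
def HasDensityOn {Ω : Type*} [MeasurableSpace Ω] (P : Measure Ω) (X : Ω → ℝ) (S : Set ℝ)
    (f : ℝ → ℝ) : Prop :=
  P.map X = (volume.restrict S).withDensity (fun x => ENNReal.ofReal (f x))

/-- The random channel coefficients and distances of the network: shadowed-Rician fading between
satellite and relay, Nakagami fading between relay and user, the distance distributions, and
independence of the four quantities. -/
structure S2GParams.IsModel (p : S2GParams) {Ω : Type*} [MeasurableSpace Ω] (P : Measure Ω)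
    (g_sr g_rd : Ω → ℂ) (w_sr w_rd : Ω → ℝ) : Prop where
  measurable_g_sr : Measurable g_sr
  measurable_g_rd : Measurable g_rd
  measurable_w_sr : Measurable w_sr
  measurable_w_rd : Measurable w_rd
  law_g_sr : HasDensityOn P (fun ω => ‖g_sr ω‖ ^ 2) (Ioi 0) p.pdfGsr
  law_g_rd : HasDensityOn P (fun ω => ‖g_rd ω‖ ^ 2) (Ioi 0) p.pdfGrd
  law_w_sr : HasDensityOn P w_sr (Icc p.w_min p.w_max) p.pdfWsr
  law_w_rd : HasDensityOn P w_rd (Icc p.h₀ p.v_max) p.pdfWrd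
  indep : iIndepFun
    ![fun ω => ‖g_sr ω‖ ^ 2, fun ω => ‖g_rd ω‖ ^ 2, w_sr, w_rd] P

namespace S2GParams

variable (p : S2GParams)

/-- `P₂(γ) = Pr[Λ_{D,2} > γ, η |g_sr|² w_sr⁻² > P_th]`. -/
def P₂ {Ω : Type*} [MeasurableSpace Ω] (P : Measure Ω) (g_sr g_rd : Ω → ℂ)
    (w_sr w_rd : Ω → ℝ) : ℝ :=
  P.real {ω | p.γ < p.snr₂ (‖g_sr ω‖ ^ 2) (‖g_rd ω‖ ^ 2) (w_sr ω) (w_rd ω) ∧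
    p.Pth < p.η * ‖g_sr ω‖ ^ 2 * (w_sr ω) ^ (-2 : ℝ)}

/-! The series `Ψ₂` -/

/-- The integrand of `I₁`. -/
def I₁Integrand (k n k₁ k₂ : ℕ) (w : ℝ) : ℝ :=
  w ^ (2 * k + n - k₁ + k₂ + 1 : ℝ) *
    Real.exp (-(p.βbar * w ^ 2 / p.A * (p.B + p.PAB / 2))) *
    whittakerW ((-n + k₁ - k₂ : ℝ) / 2) ((n - k₁ + k₂ - 1 : ℝ) / 2)
      (p.βbar * w ^ 2 * p.PAB / p.A)

def I₁ (k n k₁ k₂ : ℕ) : ℝ :=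
  ∫ w in p.w_min..p.w_max, p.I₁Integrand k n k₁ k₂ w

/-- The `k₂`-th term of the series in `Ψ₂`. -/
def Ψ₂Term (k n k₁ k₂ : ℕ) : ℝ :=
  (-1) ^ k₂ / (k₂.factorial : ℝ) *
    p.βbar ^ ((n - k₁ + k₂ : ℝ) / 2 - 1) *
    (p.PAB ^ ((-n + k₁ - k₂ : ℝ) / 2) * p.B ^ (k + n - k₁ + k₂ : ℝ) /
      p.A ^ (k + 1 + (n - k₁ + k₂ - 2 : ℝ) / 2 - 2 / p.ν)) *
    deltaGamma (n + k₂ + 2 / p.ν)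
      (p.m_rd * p.σd ^ 2 * p.γ * p.η * p.h₀ ^ p.ν / (p.A * p.Pth))
      (p.m_rd * p.σd ^ 2 * p.γ * p.η * (p.h₀ ^ 2 + p.l ^ 2) ^ (p.ν / 2) / (p.A * p.Pth)) *
    p.I₁ k n k₁ k₂

def Ψ₂ : ℝ :=
  2 * p.α / (p.l ^ 2 * p.w_er * p.w_min * p.ν) *
    (p.m_rd * p.σd ^ 2 * p.γ * p.η / p.Pth) ^ (-(2 / p.ν)) *
    ∑ k ∈ Finset.range p.m_sr, p.ζ k *
      ∑ n ∈ Finset.range p.m_rd, 1 / (n.factorial : ℝ) *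
        ∑ k₁ ∈ Finset.range (k + n + 1), ((k + n).choose k₁ : ℝ) *
          ∑' k₂ : ℕ, p.Ψ₂Term k n k₁ k₂

/-! The series `Ψ₃` -/

def ς₂ (n k₁ k₂ : ℕ) : ℝ := (n + k₁ + 2 * k₂ + 1 : ℝ) / 2

def ς₃ (n k₁ : ℕ) : ℝ := (-n + k₁ + 1 : ℝ) / 2

/-- The integrand of `I₂`. -/
def I₂Integrand (k n k₁ k₂ : ℕ) (w : ℝ) : ℝ :=
  ((p.h₀ ^ 2 + p.l ^ 2) ^ (p.ν * ς₂ n k₁ k₂ / 2 + 1) *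
      meijerG2113 (1 - ς₂ n k₁ k₂ - 2 / p.ν) (ς₃ n k₁) (-ς₃ n k₁) (-ς₂ n k₁ k₂ - 2 / p.ν)
        (p.m_rd * p.σd ^ 2 * p.η * p.γ * (p.h₀ ^ 2 + p.l ^ 2) ^ (p.ν / 2) *
          p.B * p.βbar * w ^ 2 / (p.A ^ 2 * p.Pth)) -
    p.h₀ ^ (p.ν * ς₂ n k₁ k₂ + 2) *
      meijerG2113 (1 - ς₂ n k₁ k₂ - 2 / p.ν) (ς₃ n k₁) (-ς₃ n k₁) (-ς₂ n k₁ k₂ - 2 / p.ν)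
        (p.m_rd * p.σd ^ 2 * p.η * p.γ * p.h₀ ^ p.ν *
          p.B * p.βbar * w ^ 2 / (p.A ^ 2 * p.Pth))) *
    w ^ (2 * k + n - k₁ + 2 : ℝ) * Real.exp (-(p.B * p.βbar * w ^ 2 / p.A))

def I₂ (k n k₁ k₂ : ℕ) : ℝ :=
  ∫ w in p.w_min..p.w_max, p.I₂Integrand k n k₁ k₂ w

/-- The `k₂`-th term of the series in `Ψ₃`. -/
def Ψ₃Term (k n k₁ k₂ : ℕ) : ℝ :=
  (-1) ^ k₂ / ((n.factorial : ℝ) * (k₂.factorial : ℝ)) *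
    (p.βbar ^ ((n - k₁ - 1 : ℝ) / 2) * p.B ^ ((2 * k + n - k₁ + 1 : ℝ) / 2) /
      p.A ^ (k + n + 1 + k₂)) *
    (p.m_rd * p.σd ^ 2 * p.η * p.γ / p.Pth) ^ ((n + k₁ + 1 : ℝ) / 2 + k₂) *
    p.I₂ k n k₁ k₂

def Ψ₃ : ℝ :=
  2 * p.α / (p.l ^ 2 * p.w_er * p.w_min * p.ν) *
    ∑ k ∈ Finset.range p.m_sr, p.ζ k *
      ∑ n ∈ Finset.range p.m_rd,
        ∑ k₁ ∈ Finset.range (k + n + 1), ((k + n).choose k₁ : ℝ) *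
          ∑' k₂ : ℕ, p.Ψ₃Term k n k₁ k₂

end S2GParams

end

/-! Put X = |g_sr|², Y = |g_rd|², s = X/w² and u = A s - B. After clearing the positive denominator,
the condition on the signal-to-noise ratio says that u > 0 and that Y exceeds a multiple of v^ν s/u
(`lt_snr₂_iff`). If A ≤ 0 this never happens. If A > 0, saturation means u > P_{A,B}, so the event
lives on u > max(0, P_{A,B}).

Since Y has a Gamma law of integer shape, its tail is e^(-z) times a finite exponential sum, with z
= c v^ν (u+B)/(A u) = c v^ν/A + c v^ν B/(A u). Expanding the density of X, this sum and the powers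
of u+B writes the probability as a finite combination of integrals over (w, v, u) of kernels
containing e^(-c v^ν/A) e^(-c v^ν B/(A u)) (`IsModel.P₂_eq_sum`).

The cases differ in which exponential is expanded. If P_{A,B} > 0, then u stays away from 0 and the
second exponent is bounded. Its series leaves terms that separate: v gives an incomplete Gamma
difference and u a Whittaker function (`integral_kernelBase_mul_expU_pow`). If P_{A,B} ≤ 0, then u
reaches 0 and only the first exponent is bounded. Expanding it leaves a Bessel-type integral in u,
and integrating that against a power of v gives a difference of two Meijer functions
(`integral_kernelBase_mul_expV_pow`). Boundedness justifies termwise integration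
(`hasSum_integral_mul_exp_neg`).

The Meijer function is identified by Mellin inversion. With the parameters at hand, its
Mellin-Barnes integrand is, up to a power of x, the Mellin transform of an explicit superposition of
exponentials (`meijerLaplace`), which Fubini rewrites through the Bessel integral. -/

noncomputable section

/-! ### Integration tools -/

/-- Termwise integration of the exponential series of a bounded function. -/
theorem hasSum_integral_mul_exp_neg {α : Type*} [MeasurableSpace α] {μ : Measure α}
    {f h : α → ℝ} {C : ℝ} (hf : Integrable f μ) (hh : AEStronglyMeasurable h μ)
    (hb : ∀ᵐ x ∂μ, |h x| ≤ C) :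
    (∀ k : ℕ, Integrable (fun x => f x * h x ^ k) μ) ∧
    HasSum (fun k : ℕ => (-1) ^ k / (k.factorial : ℝ) * ∫ x, f x * h x ^ k ∂μ)
      (∫ x, f x * Real.exp (-h x) ∂μ) := by
  have hpow : ∀ k : ℕ, ∀ᵐ x ∂μ, ‖h x ^ k‖ ≤ C ^ k := fun k => by
    filter_upwards [hb] with x hx
    rw [norm_pow]
    exact pow_le_pow_left₀ (norm_nonneg _) hx k
  have hint : ∀ k : ℕ, Integrable (fun x => f x * h x ^ k) μ := fun k =>
    hf.mul_bdd (hh.pow k) (hpow k)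
  refine ⟨hint, ?_⟩
  have key := hasSum_integral_of_summable_integral_norm (μ := μ) (E := ℝ)
    (F := fun (k : ℕ) x => (-1) ^ k / (k.factorial : ℝ) * (f x * h x ^ k))
    (fun k => (hint k).const_mul _) ?_
  · simp only [integral_const_mul] at key
    have htsum : ∀ x, ∑' k : ℕ, (-1) ^ k / (k.factorial : ℝ) * (f x * h x ^ k) =
        f x * Real.exp (-h x) := fun x => by
      have hexp : HasSum (fun k : ℕ => (-h x) ^ k / (k.factorial : ℝ)) (Real.exp (-h x)) := by
        rw [Real.exp_eq_exp_ℝ]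
        exact NormedSpace.expSeries_div_hasSum_exp (-h x)
      refine Eq.trans (tsum_congr fun k => ?_) (hexp.mul_left (f x)).tsum_eq
      rw [neg_pow]
      ring
    simpa only [htsum] using key
  -- The k-th term has L¹ norm at most (C^k/k!) ∫|f|.
  · refine Summable.of_nonneg_of_le (fun k => integral_nonneg fun x => norm_nonneg _) (fun k => ?_)
      ((Real.summable_pow_div_factorial C).mul_left (∫ x, ‖f x‖ ∂μ))
    rw [← integral_mul_const]
    refine integral_mono_ae ((hint k).const_mul _).norm (hf.norm.mul_const _) ?_
    filter_upwards [hpow k] with x hx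
    simp only [norm_mul, norm_div, norm_pow, norm_neg, norm_one, one_pow] at hx ⊢
    rw [Real.norm_natCast, div_mul_eq_mul_div, one_mul, mul_div_assoc]
    gcongr

theorem image_affine_Ioi {a b : ℝ} (hb : 0 < b) (c : ℝ) :
    (fun t => a + b * t) '' Ioi c = Ioi (a + b * c) := by
  ext x
  simp only [mem_image, mem_Ioi]
  constructor
  · rintro ⟨t, ht, rfl⟩
    gcongr
  · intro hx
    refine ⟨(x - a) / b, ?_, by field_simp; ring⟩
    rw [lt_div_iff₀ hb]; linarith

theorem setIntegral_Ioi_affine {a b : ℝ} (hb : 0 < b) (c : ℝ) (g : ℝ → ℝ) :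
    ∫ x in Ioi (a + b * c), g x = b * ∫ t in Ioi c, g (a + b * t) := by
  rw [← image_affine_Ioi hb, integral_image_eq_integral_abs_deriv_smul (f' := fun _ => b)
    measurableSet_Ioi]
  · simp [integral_const_mul, abs_of_pos hb]
  · intro x _
    simpa using (((hasDerivAt_id x).const_mul b).const_add a).hasDerivWithinAt
  · intro x _ y _ h
    simpa [hb.ne'] using h

theorem setLIntegral_Ioi_affine {a b : ℝ} (hb : 0 < b) (c : ℝ) (g : ℝ → ENNReal) :
    ∫⁻ x in Ioi (a + b * c), g x = ∫⁻ t in Ioi c, ENNReal.ofReal b * g (a + b * t) := by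
  rw [← image_affine_Ioi hb, lintegral_image_eq_lintegral_abs_deriv_mul (f' := fun _ => b)
    measurableSet_Ioi]
  · simp [abs_of_pos hb]
  · intro x _
    simpa using (((hasDerivAt_id x).const_mul b).const_add a).hasDerivWithinAt
  · intro x _ y _ h
    simpa [hb.ne'] using h

theorem integrableOn_rpow_mul_exp_neg_mul {a b : ℝ} (ha : 0 < a) (hb : 0 < b) :
    IntegrableOn (fun t : ℝ => t ^ (a - 1) * Real.exp (-(b * t))) (Ioi 0) := by
  have := integrableOn_rpow_mul_exp_neg_mul_rpow (s := a - 1) (p := 1) (by linarith) one_pos hb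
  refine this.congr_fun (fun x _ => ?_) measurableSet_Ioi
  simp

/-! ### The Whittaker function -/

/-- This is the evenness of the Whittaker function in its second parameter, in the instance needed
here. Write Γ(d)(1+t)^(-d) as ∫ x^(d-1) e^(-(1+t)x) dx, integrate over t first to get 1/(x+z), and
rescale x = z t. -/
theorem Gamma_mul_integral_exp_one_add_rpow {d z : ℝ} (hd : 0 < d) (hz : 0 < z) :
    Real.Gamma d * ∫ t in Ioi (0 : ℝ), Real.exp (-(z * t)) * (1 + t) ^ (-d) =
      z ^ (d - 1) * ∫ t in Ioi (0 : ℝ), Real.exp (-(z * t)) * t ^ (d - 1) * (1 + t)⁻¹ := by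
  have hinner : ∀ t ∈ Ioi (0 : ℝ), Real.Gamma d * (Real.exp (-(z * t)) * (1 + t) ^ (-d)) =
      ∫ x in Ioi (0 : ℝ), Real.exp (-(z * t)) * (x ^ (d - 1) * Real.exp (-((1 + t) * x))) := by
    intro t ht
    have ht' : 0 < 1 + t := by have : 0 < t := ht; linarith
    rw [integral_const_mul, Real.integral_rpow_mul_exp_neg_mul_Ioi hd ht', one_div,
      Real.inv_rpow ht'.le, Real.rpow_neg ht'.le]
    ring
  have hinner' : ∀ x ∈ Ioi (0 : ℝ),
      ∫ t in Ioi (0 : ℝ), Real.exp (-(z * t)) * (x ^ (d - 1) * Real.exp (-((1 + t) * x))) =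
        x ^ (d - 1) * Real.exp (-x) * (x + z)⁻¹ := by
    intro x hx
    have hxz : 0 < x + z := add_pos hx hz
    have := Real.integral_rpow_mul_exp_neg_mul_Ioi one_pos hxz
    simp only [sub_self, Real.rpow_zero, one_mul, Real.rpow_one, Real.Gamma_one, mul_one,
      one_div] at this
    rw [← this, ← integral_const_mul]
    refine setIntegral_congr_fun measurableSet_Ioi fun t _ => ?_
    rw [mul_left_comm, ← Real.exp_add, mul_assoc, ← Real.exp_add]
    ring_nf
  -- Dropping the term tx from the exponent bounds the integrand by e^(-zt) · x^(d-1) e^(-x).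
  have hint : Integrable (Function.uncurry fun t x : ℝ =>
      Real.exp (-(z * t)) * (x ^ (d - 1) * Real.exp (-((1 + t) * x))))
      ((volume.restrict (Ioi 0)).prod (volume.restrict (Ioi 0))) := by
    have h1 := integrableOn_rpow_mul_exp_neg_mul one_pos hz
    have h2 := integrableOn_rpow_mul_exp_neg_mul hd one_pos
    have h3 := h1.mul_prod h2
    refine h3.mono' (by unfold Function.uncurry; fun_prop) ?_
    rw [Measure.prod_restrict]
    filter_upwards [ae_restrict_mem (measurableSet_Ioi.prod measurableSet_Ioi)] with y hy
    obtain ⟨h1 : 0 < y.1, h2 : 0 < y.2⟩ := hy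
    simp only [Function.uncurry, sub_self, Real.rpow_zero, one_mul]
    rw [Real.norm_of_nonneg (by positivity)]
    gcongr
    nlinarith [mul_pos h1 h2]
  rw [← integral_const_mul, setIntegral_congr_fun measurableSet_Ioi hinner,
    integral_integral_swap hint, setIntegral_congr_fun measurableSet_Ioi hinner',
    ← integral_const_mul]
  have := setIntegral_Ioi_affine (a := 0) hz 0 fun x => x ^ (d - 1) * Real.exp (-x) * (x + z)⁻¹
  simp only [zero_add, mul_zero] at this
  rw [this, ← integral_const_mul]
  refine setIntegral_congr_fun measurableSet_Ioi fun t (ht : 0 < t) => ?_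
  rw [Real.mul_rpow hz.le ht.le]
  field_simp
  ring

/-- The definition uses |μ|, so it gives this integral directly only for d ≤ 1, with Gamma factor
Γ(1). For d ≥ 1 it gives the integral of t^(d-1)/(1+t), which `Gamma_mul_integral_exp_one_add_rpow`
converts. -/
theorem whittakerW_eq (d : ℝ) {z : ℝ} (hz : 0 < z) :
    whittakerW (-d / 2) ((d - 1) / 2) z = Real.exp (-z / 2) * z ^ (1 - d / 2) *
      ∫ t in Ioi (0 : ℝ), Real.exp (-(z * t)) * (1 + t) ^ (-d) := by
  unfold whittakerW
  rcases le_total d 1 with h | h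
  · rw [abs_of_nonpos (by linarith)]
    have e1 : -((d - 1) / 2) - -d / 2 + 1 / 2 = 1 := by ring
    have e2 : -((d - 1) / 2) - -d / 2 - 1 / 2 = 0 := by ring
    have e3 : -((d - 1) / 2) + -d / 2 - 1 / 2 = -d := by ring
    have e4 : -((d - 1) / 2) + 1 / 2 = 1 - d / 2 := by ring
    rw [e1, e2, e3, e4]
    simp
  · rw [abs_of_nonneg (by linarith)]
    have e1 : (d - 1) / 2 - -d / 2 + 1 / 2 = d := by ring
    have e2 : (d - 1) / 2 - -d / 2 - 1 / 2 = d - 1 := by ring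
    have e3 : (d - 1) / 2 + -d / 2 - 1 / 2 = -1 := by ring
    have e4 : (d - 1) / 2 + 1 / 2 = (1 - d / 2) + (d - 1) := by ring
    have hd : 0 < d := by linarith
    have hG := Real.Gamma_pos_of_pos hd
    have := Gamma_mul_integral_exp_one_add_rpow hd hz
    rw [e1, e2, e3, e4, Real.rpow_add hz]
    simp only [Real.rpow_neg_one]
    generalize (∫ t in Ioi (0 : ℝ), Real.exp (-(z * t)) * (1 + t) ^ (-d)) = I at this ⊢
    rw [mul_comm] at this
    rw [eq_div_of_mul_eq hG.ne' this]
    ring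

/-- The tail `∫_P^∞ u^(-d) e^(-au) du` through the Whittaker function. -/
theorem integral_Ioi_rpow_neg_mul_exp (d : ℝ) {a P : ℝ} (ha : 0 < a) (hP : 0 < P) :
    ∫ u in Ioi P, u ^ (-d) * Real.exp (-(a * u)) =
      P ^ (-d / 2) * a ^ (d / 2 - 1) * Real.exp (-(a * P / 2)) *
        whittakerW (-d / 2) ((d - 1) / 2) (a * P) := by
  -- The substitution u = P(1+t) produces the Laplace integral of `whittakerW_eq`.
  have := setIntegral_Ioi_affine (a := P) hP 0 fun u => u ^ (-d) * Real.exp (-(a * u))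
  rw [mul_zero, add_zero] at this
  rw [this, whittakerW_eq d (mul_pos ha hP)]
  have h1 : ∫ t in Ioi (0 : ℝ), (P + P * t) ^ (-d) * Real.exp (-(a * (P + P * t))) =
      P ^ (-d) * Real.exp (-(a * P)) *
        ∫ t in Ioi (0 : ℝ), Real.exp (-(a * P * t)) * (1 + t) ^ (-d) := by
    rw [← integral_const_mul]
    refine setIntegral_congr_fun measurableSet_Ioi fun t (ht : 0 < t) => ?_
    rw [show P + P * t = P * (1 + t) by ring, Real.mul_rpow hP.le (by positivity),
      show -(a * (P * (1 + t))) = -(a * P) + -(a * P * t) by ring, Real.exp_add]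
    ring
  rw [h1, Real.mul_rpow ha.le hP.le]
  have h0 : Real.exp (-(a * P)) = Real.exp (-(a * P / 2)) * Real.exp (-(a * P) / 2) := by
    rw [← Real.exp_add]; ring_nf
  rw [h0]
  have h2 : P * P ^ (-d) = P ^ (-d / 2) * P ^ (1 - d / 2) := by
    rw [← Real.rpow_add hP, show -d / 2 + (1 - d / 2) = 1 + -d by ring, Real.rpow_add hP,
      Real.rpow_one]
  have h3 : a ^ (d / 2 - 1) * a ^ (1 - d / 2) = 1 := by
    rw [← Real.rpow_add ha]; ring_nf; simp
  generalize (∫ t in Ioi (0 : ℝ), Real.exp (-(a * P * t)) * (1 + t) ^ (-d)) = I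
  linear_combination (Real.exp (-(a * P / 2)) * Real.exp (-(a * P) / 2) * I) * (h2) -
    (P ^ (-d / 2) * P ^ (1 - d / 2) * Real.exp (-(a * P / 2)) * Real.exp (-(a * P) / 2) * I) * h3

/-! ### The incomplete Gamma function -/

/-- Substitute t = c v^ν/A. The measure v dv is proportional to t^(2/ν-1) dt, whence the shift of
the Gamma index by 2/ν. -/
theorem integral_mul_rpow_pow_mul_exp {ν c A a b : ℝ} (hν : 0 < ν) (hc : 0 < c) (hA : 0 < A)
    (ha : 0 < a) (hab : a ≤ b) (N : ℕ) :
    ∫ v in Icc a b, v * (c * v ^ ν) ^ N * Real.exp (-(c * v ^ ν / A)) =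
      A ^ (N + 2 / ν) * c ^ (-(2 / ν)) / ν *
        deltaGamma (N + 2 / ν) (c * a ^ ν / A) (c * b ^ ν / A) := by
  have hb : 0 < b := ha.trans_le hab
  have hmono : StrictMonoOn (fun v : ℝ => c * v ^ ν / A) (Ioi 0) := by
    intro x hx y hy hxy
    have := Real.rpow_lt_rpow (le_of_lt hx) hxy hν
    simp only
    gcongr
  have himg : (fun v : ℝ => c * v ^ ν / A) '' Ioc a b = Ioc (c * a ^ ν / A) (c * b ^ ν / A) := by
    ext y
    simp only [mem_image, mem_Ioc]
    constructor
    · rintro ⟨v, ⟨h1, h2⟩, rfl⟩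
      have hv : 0 < v := ha.trans h1
      exact ⟨hmono ha hv h1, hmono.monotoneOn hv hb h2⟩
    · rintro ⟨h1, h2⟩
      have hy : 0 < y := lt_trans (by positivity) h1
      have hfy : c * ((A * y / c) ^ (1 / ν)) ^ ν / A = y := by
        rw [← Real.rpow_mul (by positivity), one_div_mul_cancel hν.ne', Real.rpow_one]
        field_simp
      have hpos : 0 < (A * y / c) ^ (1 / ν) := by positivity
      refine ⟨(A * y / c) ^ (1 / ν), ⟨?_, ?_⟩, hfy⟩
      · rw [← hfy] at h1
        exact (hmono.lt_iff_lt ha hpos).1 h1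
      · rw [← hfy] at h2
        exact (hmono.le_iff_le hpos hb).1 h2
  have hle : c * a ^ ν / A ≤ c * b ^ ν / A := hmono.monotoneOn ha hb hab
  have hpos : 0 < c * a ^ ν / A := by positivity
  have hG : IntegrableOn (fun t : ℝ => t ^ ((N + 2 / ν) - 1) * Real.exp (-t)) (Ioi 0) := by
    simpa using integrableOn_rpow_mul_exp_neg_mul (a := N + 2 / ν) (b := 1) (by positivity) one_pos
  have hdelta : deltaGamma (N + 2 / ν) (c * a ^ ν / A) (c * b ^ ν / A) =
      ∫ t in Ioc (c * a ^ ν / A) (c * b ^ ν / A), t ^ ((N + 2 / ν) - 1) * Real.exp (-t) := by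
    unfold deltaGamma upperGamma
    rw [← Ioc_union_Ioi_eq_Ioi hle, setIntegral_union (Ioc_disjoint_Ioi le_rfl) measurableSet_Ioi
      (hG.mono_set fun x hx => hpos.trans hx.1)
      (hG.mono_set fun x hx => (hpos.trans_le hle).trans hx)]
    ring
  rw [hdelta, ← himg, integral_image_eq_integral_abs_deriv_smul
    (f' := fun v => c * (ν * v ^ (ν - 1)) / A) measurableSet_Ioc, integral_Icc_eq_integral_Ioc,
    ← integral_const_mul]
  · refine setIntegral_congr_fun measurableSet_Ioc fun v hv => ?_
    have hv : 0 < v := ha.trans hv.1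
    simp only [smul_eq_mul]
    rw [abs_of_pos (by positivity)]
    have e1 : (c * v ^ ν / A) ^ ((N + 2 / ν : ℝ) - 1) =
        (c * v ^ ν) ^ N * (A ^ (N + 2 / ν))⁻¹ * c ^ (2 / ν) * v ^ 2 * (A / (c * v ^ ν)) := by
      rw [Real.rpow_sub_one (by positivity), Real.div_rpow (by positivity) hA.le,
        Real.rpow_add (by positivity : 0 < c * v ^ ν), Real.rpow_natCast,
        Real.mul_rpow hc.le (by positivity), ← Real.rpow_mul hv.le,
        show ν * (2 / ν) = (2 : ℕ) by push_cast; field_simp, Real.rpow_natCast]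
      field_simp
    rw [e1, Real.rpow_sub_one hv.ne', Real.rpow_neg hc.le]
    have := Real.rpow_pos_of_pos hA (N + 2 / ν)
    have := Real.rpow_pos_of_pos hc (2 / ν)
    have := Real.rpow_pos_of_pos hv ν
    field_simp
  · intro v hv
    have hv : 0 < v := ha.trans hv.1
    exact (((Real.hasDerivAt_rpow_const (Or.inl hv.ne')).const_mul c).div_const A).hasDerivWithinAt
  · exact hmono.injOn.mono fun v hv => ha.trans hv.1

/-! ### Gamma on vertical lines -/

theorem norm_Gamma_le_Gamma_re {s : ℂ} (hs : 0 < s.re) : ‖Complex.Gamma s‖ ≤ Real.Gamma s.re := by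
  rw [Complex.Gamma_eq_integral hs, Real.Gamma_eq_integral hs, Complex.GammaIntegral]
  refine norm_integral_le_of_norm_le (Real.GammaIntegral_convergent hs) ?_
  filter_upwards [ae_restrict_mem measurableSet_Ioi] with x (hx : 0 < x)
  rw [norm_mul, Complex.norm_cpow_eq_rpow_re_of_pos hx, Complex.norm_real,
    Real.norm_of_nonneg (Real.exp_pos _).le]
  simp

/-- On the line, |s Γ(s)| = |Γ(s+1)| ≤ Γ(a+1), so |Γ(s)|² is at most Γ(a+1)²/(a²+y²). The constant
comes from 1+y² ≤ (1+a⁻²)(a²+y²). -/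
theorem norm_Gamma_sq_le {a : ℝ} (ha : 0 < a) :
    ∃ C : ℝ, ∀ y : ℝ, ‖Complex.Gamma (a + y * Complex.I)‖ ^ 2 ≤ C * (1 + y ^ 2)⁻¹ := by
  refine ⟨Real.Gamma (a + 1) ^ 2 * (1 + (a ^ 2)⁻¹), fun y => ?_⟩
  set s : ℂ := a + y * Complex.I with hs
  have hre : s.re = a := by simp [hs]
  have him : s.im = y := by simp [hs]
  have hs0 : s ≠ 0 := fun h => by rw [h] at hre; simp at hre; linarith
  have h1 : ‖s‖ ^ 2 = a ^ 2 + y ^ 2 := by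
    rw [Complex.sq_norm, Complex.normSq_apply, hre, him]; ring
  have h2 := norm_Gamma_le_Gamma_re (s := s + 1) (by simp [hre]; linarith)
  rw [Complex.Gamma_add_one s hs0, norm_mul, Complex.add_re, hre, Complex.one_re] at h2
  have h3 : (‖s‖ * ‖Complex.Gamma s‖) ^ 2 ≤ Real.Gamma (a + 1) ^ 2 := by gcongr
  rw [mul_pow, h1] at h3
  have h4 : (1 + y ^ 2) ≤ (1 + (a ^ 2)⁻¹) * (a ^ 2 + y ^ 2) := by
    have : (a ^ 2)⁻¹ * a ^ 2 = 1 := inv_mul_cancel₀ (by positivity)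
    have h5 : 0 ≤ (a ^ 2)⁻¹ * y ^ 2 := by positivity
    nlinarith [sq_nonneg a]
  rw [← div_eq_mul_inv, le_div_iff₀ (by positivity)]
  calc ‖Complex.Gamma s‖ ^ 2 * (1 + y ^ 2)
      ≤ ‖Complex.Gamma s‖ ^ 2 * ((1 + (a ^ 2)⁻¹) * (a ^ 2 + y ^ 2)) := by gcongr
    _ = ((a ^ 2 + y ^ 2) * ‖Complex.Gamma s‖ ^ 2) * (1 + (a ^ 2)⁻¹) := by ring
    _ ≤ _ := by gcongr

theorem continuous_Gamma_vertical {a : ℝ} (ha : 0 < a) :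
    Continuous fun y : ℝ => Complex.Gamma (a + y * Complex.I) := by
  refine continuous_iff_continuousAt.2 fun y => ?_
  have h : DifferentiableAt ℂ Complex.Gamma (a + y * Complex.I) := by
    refine Complex.differentiableAt_Gamma _ fun m h => ?_
    have := congrArg Complex.re h
    simp at this
    have : (0 : ℝ) ≤ m := m.cast_nonneg
    linarith
  exact h.continuousAt.comp (f := fun y : ℝ => (a + y * Complex.I : ℂ)) (by fun_prop)

/-- The product is bounded by a sum of squares, so quadratic decay of each |Γ|² suffices; the true
exponential decay is not needed for Mellin inversion. -/
theorem integrable_Gamma_mul_Gamma_vertical {a b : ℝ} (ha : 0 < a) (hb : 0 < b) :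
    Integrable fun y : ℝ => Complex.Gamma (a + y * Complex.I) * Complex.Gamma (b + y * Complex.I) := by
  obtain ⟨C, hC⟩ := norm_Gamma_sq_le ha
  obtain ⟨D, hD⟩ := norm_Gamma_sq_le hb
  refine (integrable_inv_one_add_sq.const_mul (C + D)).mono'
    ((continuous_Gamma_vertical ha).mul (continuous_Gamma_vertical hb)).aestronglyMeasurable
    (Filter.Eventually.of_forall fun y => ?_)
  rw [norm_mul]
  nlinarith [hC y, hD y, sq_nonneg (‖Complex.Gamma (a + y * Complex.I)‖ -
    ‖Complex.Gamma (b + y * Complex.I)‖), sq_nonneg ‖Complex.Gamma (a + y * Complex.I)‖,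
    sq_nonneg ‖Complex.Gamma (b + y * Complex.I)‖]

/-! ### Mellin transforms of superpositions of exponentials -/

/-- Fubini and ∫ x^(r-1) e^(-κx) dx = Γ(r) κ^(-r). The hypothesis `hint` is the absolute convergence
that Fubini requires. -/
theorem hasMellin_integral_exp {α : Type*} [MeasurableSpace α] {μ : Measure α} [SFinite μ]
    {wt κ : α → ℝ} (hwt : Measurable wt) (hκ : Measurable κ) (hwt0 : ∀ᵐ y ∂μ, 0 ≤ wt y)
    (hκ0 : ∀ᵐ y ∂μ, 0 < κ y) {r : ℂ} (hr : 0 < r.re)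
    (hint : Integrable (fun y => wt y * κ y ^ (-r.re)) μ) :
    HasMellin (fun x : ℝ => ((∫ y, wt y * Real.exp (-(κ y * x)) ∂μ : ℝ) : ℂ)) r
      (Complex.Gamma r * ∫ y, (wt y : ℂ) * (κ y : ℂ) ^ (-r) ∂μ) := by
  have hF : Integrable (Function.uncurry fun (x : ℝ) (y : α) =>
      (x : ℂ) ^ (r - 1) * ((wt y * Real.exp (-(κ y * x)) : ℝ) : ℂ))
      ((volume.restrict (Ioi 0)).prod μ) := by
    have hm : Measurable (Function.uncurry fun (x : ℝ) (y : α) =>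
      (x : ℂ) ^ (r - 1) * ((wt y * Real.exp (-(κ y * x)) : ℝ) : ℂ)) := by
      unfold Function.uncurry
      fun_prop
    refine (integrable_prod_iff' hm.aestronglyMeasurable).2 ⟨?_, ?_⟩
    · filter_upwards [hκ0] with y hy
      have h := (integrableOn_rpow_mul_exp_neg_mul hr hy).const_mul |wt y|
      refine h.mono' (hm.comp (by fun_prop : Measurable fun x : ℝ => (x, y))).aestronglyMeasurable ?_
      filter_upwards [ae_restrict_mem measurableSet_Ioi] with x (hx : 0 < x)
      simp only [Function.uncurry]
      rw [norm_mul, Complex.norm_cpow_eq_rpow_re_of_pos hx, Complex.norm_real, norm_mul,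
        Real.norm_of_nonneg (Real.exp_pos _).le, Real.norm_eq_abs]
      simp only [Complex.sub_re, Complex.one_re]
      exact le_of_eq (by ring)
    · refine (hint.const_mul (Real.Gamma r.re)).congr ?_
      filter_upwards [hκ0, hwt0] with y hy hwy
      have : ∀ x ∈ Ioi (0 : ℝ), ‖(Function.uncurry fun (x : ℝ) (y : α) =>
          (x : ℂ) ^ (r - 1) * ((wt y * Real.exp (-(κ y * x)) : ℝ) : ℂ)) (x, y)‖ =
          wt y * (x ^ (r.re - 1) * Real.exp (-(κ y * x))) := fun x (hx : 0 < x) => by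
        simp only [Function.uncurry]
        rw [norm_mul, Complex.norm_cpow_eq_rpow_re_of_pos hx, Complex.norm_real,
          Real.norm_of_nonneg (by positivity)]
        simp only [Complex.sub_re, Complex.one_re]
        ring
      rw [setIntegral_congr_fun measurableSet_Ioi this, integral_const_mul,
        Real.integral_rpow_mul_exp_neg_mul_Ioi hr hy, one_div, Real.inv_rpow hy.le,
        Real.rpow_neg hy.le]
      ring
  have hconv : ∀ x : ℝ, ∫ y, (x : ℂ) ^ (r - 1) * ((wt y * Real.exp (-(κ y * x)) : ℝ) : ℂ) ∂μ =
      (x : ℂ) ^ (r - 1) • ((∫ y, wt y * Real.exp (-(κ y * x)) ∂μ : ℝ) : ℂ) := fun x => by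
    rw [integral_const_mul, integral_complex_ofReal, smul_eq_mul]
  refine ⟨?_, ?_⟩
  · have := hF.integral_prod_left
    simp only [Function.uncurry, hconv] at this
    exact this
  · unfold mellin
    simp only [← hconv]
    rw [integral_integral_swap hF, ← integral_const_mul]
    refine integral_congr_ae ?_
    filter_upwards [hκ0] with y hy
    have := Complex.integral_cpow_mul_exp_neg_mul_Ioi hr hy
    have h2 : ∀ x : ℝ, (x : ℂ) ^ (r - 1) * ((wt y * Real.exp (-(κ y * x)) : ℝ) : ℂ) =
        (wt y : ℂ) * ((x : ℂ) ^ (r - 1) * Complex.exp (-((κ y : ℂ) * x))) := fun x => by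
      push_cast; ring
    simp only [h2]
    rw [integral_const_mul, this, one_div, Complex.inv_cpow _ _ (by
      rw [Complex.arg_ofReal_of_nonneg hy.le]; exact Real.pi_pos.ne), Complex.cpow_neg]
    ring

/-- Raise t/r ≤ e^(t/r) to the power r. It bounds an exponential by a power, so that integrability
of a superposition follows from a moment. -/
theorem exp_neg_le_rpow_neg {r t : ℝ} (hr : 0 < r) (ht : 0 < t) :
    Real.exp (-t) ≤ r ^ r * t ^ (-r) := by
  have h1 : (t / r) ^ r ≤ Real.exp t := by
    calc (t / r) ^ r ≤ Real.exp (t / r) ^ r := by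
          gcongr
          linarith [Real.add_one_le_exp (t / r)]
      _ = Real.exp t := by rw [← Real.exp_mul, div_mul_cancel₀ _ hr.ne']
  rw [Real.div_rpow ht.le hr.le] at h1
  rw [Real.exp_neg, Real.rpow_neg ht.le, ← div_eq_mul_inv]
  have := Real.rpow_pos_of_pos hr r
  have := Real.rpow_pos_of_pos ht r
  rw [inv_le_comm₀ (Real.exp_pos _) (by positivity), inv_div]
  exact h1

/-- For arguments above x/2 the integrand is dominated by its absolute value at x/2. -/
theorem continuousAt_integral_exp {α : Type*} [MeasurableSpace α] {μ : Measure α}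
    {wt κ : α → ℝ} (hwt : Measurable wt) (hκ : Measurable κ)
    (hκ0 : ∀ᵐ y ∂μ, 0 < κ y) {x : ℝ}
    (hint : ∀ x, 0 < x → Integrable (fun y => wt y * Real.exp (-(κ y * x))) μ) (hx : 0 < x) :
    ContinuousAt (fun x : ℝ => ((∫ y, wt y * Real.exp (-(κ y * x)) ∂μ : ℝ) : ℂ)) x := by
  refine Complex.continuous_ofReal.continuousAt.comp ?_
  refine continuousAt_of_dominated (Filter.Eventually.of_forall fun x => by fun_prop)
    (bound := fun y => ‖wt y * Real.exp (-(κ y * (x / 2)))‖) ?_ (hint _ (half_pos hx)).norm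
    (Filter.Eventually.of_forall fun y => by fun_prop)
  filter_upwards [lt_mem_nhds (half_lt_self hx)] with z hz
  filter_upwards [hκ0] with y hy
  rw [norm_mul, norm_mul, Real.norm_of_nonneg (Real.exp_pos _).le,
    Real.norm_of_nonneg (Real.exp_pos _).le]
  gcongr

/-! ### The Meijer function `G^{2,1}_{1,3}` -/

theorem integral_Ioo_cpow {w : ℂ} (hw : 0 < w.re) :
    ∫ θ in Ioo (0 : ℝ) 1, (θ : ℂ) ^ (w - 1) = w⁻¹ := by
  have hw0 : w ≠ 0 := fun h => by simp [h] at hw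
  rw [← integral_Ioc_eq_integral_Ioo, ← intervalIntegral.integral_of_le zero_le_one,
    integral_cpow (Or.inl (by simpa using hw))]
  simp [hw0]

theorem integrableOn_Ioo_rpow {w : ℝ} (hw : 0 < w) :
    IntegrableOn (fun θ : ℝ => θ ^ (w - 1)) (Ioo 0 1) := by
  rw [← integrableOn_Ioc_iff_integrableOn_Ioo, ← intervalIntegrable_iff_integrableOn_Ioc_of_le
    zero_le_one]
  exact intervalIntegral.intervalIntegrable_rpow' (by linarith)

/-- The weight of the representation of `G^{2,1}_{1,3}` by exponentials. -/
def meijerWeight (q ς : ℝ) (y : ℝ × ℝ) : ℝ :=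
  y.1 ^ (q - ς - 1) * (y.2 ^ (2 * ς - 1) * Real.exp (-y.2))

theorem measurable_meijerWeight (q ς : ℝ) : Measurable (meijerWeight q ς) := by
  unfold meijerWeight
  fun_prop

theorem ae_pos_strip : ∀ᵐ y : ℝ × ℝ
    ∂((volume.restrict (Ioo (0 : ℝ) 1)).prod (volume.restrict (Ioi (0 : ℝ)))),
      0 < y.1 ∧ 0 < y.2 := by
  rw [Measure.prod_restrict]
  filter_upwards [ae_restrict_mem (measurableSet_Ioo.prod measurableSet_Ioi)] with y hy
  exact ⟨hy.1.1, hy.2⟩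

/-- The factor (θ/τ)^(-z) only shifts exponents, to θ^(q-ς-z-1) and τ^(2ς+z-1). The two hypotheses
are convergence at θ = 0 and at τ = 0. -/
theorem integrable_meijerWeight_mul_rpow {q ς z : ℝ} (h1 : z < q - ς) (h2 : 0 < 2 * ς + z) :
    Integrable (fun y => meijerWeight q ς y * (y.1 / y.2) ^ (-z))
      ((volume.restrict (Ioo (0 : ℝ) 1)).prod (volume.restrict (Ioi (0 : ℝ)))) := by
  refine ((integrableOn_Ioo_rpow (w := q - ς - z) (by linarith)).mul_prod
    (integrableOn_rpow_mul_exp_neg_mul h2 one_pos)).congr ?_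
  filter_upwards [ae_pos_strip] with y ⟨hy1, hy2⟩
  unfold meijerWeight
  rw [Real.div_rpow hy1.le hy2.le, Real.rpow_neg hy2.le z, div_inv_eq_mul,
    show q - ς - z - 1 = (q - ς - 1) + -z by ring, Real.rpow_add hy1,
    show 2 * ς + z - 1 = (2 * ς - 1) + z by ring, Real.rpow_add hy2, one_mul]
  ring

theorem integral_meijerWeight_mul_cpow {q ς : ℝ} {z : ℂ} (h1 : z.re < q - ς)
    (h2 : 0 < 2 * ς + z.re) :
    ∫ y, (meijerWeight q ς y : ℂ) * ((y.1 / y.2 : ℝ) : ℂ) ^ (-z)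
      ∂((volume.restrict (Ioo (0 : ℝ) 1)).prod (volume.restrict (Ioi (0 : ℝ)))) =
    (q - ς - z)⁻¹ * Complex.Gamma (2 * ς + z) := by
  have hG := Complex.integral_cpow_mul_exp_neg_mul_Ioi (a := 2 * ς + z) (r := 1)
    (by simpa using h2) one_pos
  simp only [Complex.ofReal_one, one_mul, div_one, Complex.one_cpow] at hG
  rw [← integral_Ioo_cpow (by simpa using h1), ← hG, ← integral_prod_mul]
  refine integral_congr_ae ?_
  filter_upwards [ae_pos_strip] with y ⟨hy1, hy2⟩
  unfold meijerWeight
  have c1 : (y.1 : ℂ) ≠ 0 := by exact_mod_cast hy1.ne'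
  have c2 : (y.2 : ℂ) ≠ 0 := by exact_mod_cast hy2.ne'
  push_cast
  rw [Complex.ofReal_cpow hy1.le, Complex.ofReal_cpow hy2.le, div_eq_mul_inv,
    ← Complex.ofReal_inv, Complex.mul_cpow_ofReal_nonneg hy1.le (inv_pos.2 hy2).le,
    Complex.ofReal_inv, Complex.inv_cpow _ _ (by
      rw [Complex.arg_ofReal_of_nonneg hy2.le]; exact Real.pi_pos.ne), ← Complex.cpow_neg,
    neg_neg, show (q - ς - z - 1 : ℂ) = (q - ς - 1) + -z by ring, Complex.cpow_add _ _ c1,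
    show (2 * ς + z - 1 : ℂ) = (2 * ς - 1) + z by ring, Complex.cpow_add _ _ c2]
  push_cast
  ring

/-- The Laplace superposition behind `G^{2,1}_{1,3}`. -/
def meijerLaplace (q ς x : ℝ) : ℝ :=
  ∫ y, meijerWeight q ς y * Real.exp (-(y.1 / y.2 * x))
    ∂((volume.restrict (Ioo (0 : ℝ) 1)).prod (volume.restrict (Ioi (0 : ℝ))))

theorem integrable_meijerLaplace {q ς x : ℝ} (hq : |ς| < q) (hx : 0 < x) :
    Integrable (fun y => meijerWeight q ς y * Real.exp (-(y.1 / y.2 * x)))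
      ((volume.restrict (Ioo (0 : ℝ) 1)).prod (volume.restrict (Ioi (0 : ℝ)))) := by
  -- Any σ in (|ς|, q) makes z = σ - ς positive and admissible for the moment bound.
  obtain ⟨σ, h1, h2⟩ := exists_between hq
  obtain ⟨h3, h4⟩ := abs_lt.1 h1
  have hz : 0 < σ - ς := by linarith
  refine ((integrable_meijerWeight_mul_rpow (q := q) (ς := ς) (z := σ - ς) (by linarith)
    (by linarith)).const_mul ((σ - ς) ^ (σ - ς) * x ^ (-(σ - ς)))).mono' ?_ ?_
  · have := measurable_meijerWeight q ς
    fun_prop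
  filter_upwards [ae_pos_strip] with y ⟨hy1, hy2⟩
  have hw : 0 ≤ meijerWeight q ς y := by unfold meijerWeight; positivity
  have := exp_neg_le_rpow_neg hz (mul_pos (div_pos hy1 hy2) hx)
  rw [Real.mul_rpow (by positivity) hx.le] at this
  rw [Real.norm_of_nonneg (by positivity)]
  calc _ ≤ meijerWeight q ς y * _ := mul_le_mul_of_nonneg_left this hw
    _ = _ := by ring

/-- The transform is Γ(z) times the moment of order -z of θ/τ. It is the Mellin-Barnes integrand of
the Meijer function, without its power of x, at s = -ς - z. -/
theorem hasMellin_meijerLaplace {q ς : ℝ} {z : ℂ} (h0 : 0 < z.re) (h1 : z.re < q - ς)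
    (h2 : 0 < 2 * ς + z.re) :
    HasMellin (fun x => (meijerLaplace q ς x : ℂ)) z
      (Complex.Gamma z * ((q - ς - z)⁻¹ * Complex.Gamma (2 * ς + z))) := by
  rw [← integral_meijerWeight_mul_cpow h1 h2]
  refine hasMellin_integral_exp (measurable_meijerWeight q ς) (by fun_prop) ?_ ?_ h0
    (integrable_meijerWeight_mul_rpow h1 h2)
  · filter_upwards [ae_pos_strip] with y ⟨hy1, hy2⟩
    unfold meijerWeight
    positivity
  · filter_upwards [ae_pos_strip] with y ⟨hy1, hy2⟩
    positivity

theorem mellinInv_meijerLaplace {q ς σ x : ℝ} (h0 : 0 < σ) (h1 : σ < q - ς)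
    (h2 : 0 < 2 * ς + σ) (hq : |ς| < q) (hx : 0 < x) :
    mellinInv σ (fun z => Complex.Gamma z * ((q - ς - z)⁻¹ * Complex.Gamma (2 * ς + z))) x =
      meijerLaplace q ς x := by
  have hM : ∀ y : ℝ, mellin (fun x => (meijerLaplace q ς x : ℂ)) (σ + y * Complex.I) =
      Complex.Gamma (σ + y * Complex.I) * ((q - ς - (σ + y * Complex.I))⁻¹ *
        Complex.Gamma (2 * ς + (σ + y * Complex.I))) := fun y =>
    (hasMellin_meijerLaplace (by simpa using h0) (by simpa using h1) (by simpa using h2)).2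
  rw [← mellinInv_mellin_eq σ (fun x => (meijerLaplace q ς x : ℂ)) hx
    (hasMellin_meijerLaplace (by simpa using h0) (by simpa using h1) (by simpa using h2)).1 ?_ ?_]
  · unfold mellinInv
    simp only [hM]
  · unfold Complex.VerticalIntegrable
    simp only [hM]
    have hI := integrable_Gamma_mul_Gamma_vertical h0 h2
    have hne : ∀ y : ℝ, (q - ς - (σ + y * Complex.I) : ℂ) ≠ 0 := fun y h => by
      have := congrArg Complex.re h
      simp at this
      linarith
    -- The rational factor is bounded on the line because the modulus of its denominator is at least
    -- the real part q - ς - σ > 0.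
    refine (hI.bdd_mul (c := (q - ς - σ)⁻¹)
      (f := fun y : ℝ => (q - ς - (σ + y * Complex.I) : ℂ)⁻¹) ?_ ?_).congr ?_
    · exact (Continuous.inv₀ (by fun_prop) hne).aestronglyMeasurable
    · refine Filter.Eventually.of_forall fun y => ?_
      rw [norm_inv]
      have h3 := Complex.abs_re_le_norm (q - ς - (σ + y * Complex.I) : ℂ)
      simp at h3
      exact inv_anti₀ (by linarith) ((le_abs_self _).trans h3)
    · refine Filter.Eventually.of_forall fun y => ?_
      simp only
      push_cast
      rw [show (2 * ς + σ + y * Complex.I : ℂ) = 2 * ς + (σ + y * Complex.I) by ring]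
      ring
  · exact continuousAt_integral_exp (measurable_meijerWeight q ς) (by fun_prop)
      (by filter_upwards [ae_pos_strip] with y ⟨hy1, hy2⟩; positivity)
      (fun x hx => integrable_meijerLaplace hq hx) hx

/-- Here Γ(q+s)/Γ(1+q+s) = 1/(q+s), and s = -ς - z turns the Mellin-Barnes integral into x^(-ς)
times an inverse Mellin transform. -/
theorem meijerG2113_eq {q ς x : ℝ} (hq : |ς| < q) (hx : 0 < x) :
    meijerG2113 (1 - q) ς (-ς) (-q) x = x ^ (-ς) * meijerLaplace q ς x := by
  have hex : ∃ c : ℝ, (∀ j : Fin 1, (![1 - q] : Fin 1 → ℝ) j - 1 < c) ∧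
      (∀ j : Fin 2, c < (![ς, -ς] : Fin 2 → ℝ) j) := by
    obtain ⟨σ, h1, h2⟩ := exists_between hq
    obtain ⟨h3, h4⟩ := abs_lt.1 h1
    refine ⟨-σ, fun j => ?_, fun j => ?_⟩
    · fin_cases j; simp; linarith
    · fin_cases j <;> simp <;> linarith
  unfold meijerG2113 meijerG
  rw [dif_pos hex]
  obtain ⟨hc1, hc2⟩ := hex.choose_spec
  -- Only -q < c < -|ς| is known of the chosen abscissa; inversion along Re z = -c - ς gives the
  -- same value for all of them.
  generalize hex.choose = c at hc1 hc2
  have k1 := hc1 0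
  have k2 := hc2 0
  have k3 := hc2 1
  simp only [Matrix.cons_val_zero, Matrix.cons_val_one] at k1 k2 k3
  have hxc : (x : ℂ) ≠ 0 := by exact_mod_cast hx.ne'
  have hinv := mellinInv_meijerLaplace (q := q) (ς := ς) (σ := -c - ς) (x := x) (by linarith)
    (by linarith) (by linarith) hq hx
  have hint : ∀ y : ℝ, meijerIntegrand ![1 - q] ![] ![ς, -ς] ![-q] x (c + (-y : ℝ) * Complex.I) =
      ((x ^ (-ς) : ℝ) : ℂ) * ((x : ℂ) ^ (-(((-c - ς : ℝ) : ℂ) + y * Complex.I)) •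
        (Complex.Gamma (((-c - ς : ℝ) : ℂ) + y * Complex.I) *
          ((q - ς - (((-c - ς : ℝ) : ℂ) + y * Complex.I))⁻¹ *
            Complex.Gamma (2 * ς + (((-c - ς : ℝ) : ℂ) + y * Complex.I))))) := fun y => by
    have hne : (q + (c + (-y : ℝ) * Complex.I) : ℂ) ≠ 0 := fun h => by
      have := congrArg Complex.re h
      simp at this
      linarith
    have hG : Complex.Gamma (q + (c + (-y : ℝ) * Complex.I)) ≠ 0 :=
      Complex.Gamma_ne_zero_of_re_pos (by simp; linarith)
    unfold meijerIntegrand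
    simp only [Fin.prod_univ_two, Fin.prod_univ_one, Fin.prod_univ_zero, Matrix.cons_val_zero,
      Matrix.cons_val_one, mul_one, smul_eq_mul]
    rw [Complex.ofReal_cpow hx.le, show ((1 : ℂ) - ((-q : ℝ) : ℂ) + (c + (-y : ℝ) * Complex.I)) =
      (q + (c + (-y : ℝ) * Complex.I)) + 1 by push_cast; ring, Complex.Gamma_add_one _ hne,
      show ((1 : ℂ) - ((1 - q : ℝ) : ℂ) + (c + (-y : ℝ) * Complex.I)) =
      (q + (c + (-y : ℝ) * Complex.I)) by push_cast; ring,
      show (q - ς - (((-c - ς : ℝ) : ℂ) + y * Complex.I)) = q + (c + (-y : ℝ) * Complex.I) by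
        push_cast; ring,
      show (c + (-y : ℝ) * Complex.I : ℂ) = ((-ς : ℝ) : ℂ) +
        -(((-c - ς : ℝ) : ℂ) + y * Complex.I) by push_cast; ring, Complex.cpow_add _ _ hxc]
    rw [show (c + (-y : ℝ) * Complex.I : ℂ) = ((-ς : ℝ) : ℂ) +
        -(((-c - ς : ℝ) : ℂ) + y * Complex.I) by push_cast; ring] at hne hG
    rw [show (ς : ℂ) - (((-ς : ℝ) : ℂ) + -(((-c - ς : ℝ) : ℂ) + y * Complex.I)) =
      2 * ς + (((-c - ς : ℝ) : ℂ) + y * Complex.I) by push_cast; ring,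
      show ((-ς : ℝ) : ℂ) - (((-ς : ℝ) : ℂ) + -(((-c - ς : ℝ) : ℂ) + y * Complex.I)) =
      (((-c - ς : ℝ) : ℂ) + y * Complex.I) by push_cast; ring]
    field_simp
  -- Passing from s to z = -ς - s reverses the direction of the vertical line.
  rw [← integral_neg_eq_self]
  simp only [hint]
  rw [integral_const_mul]
  unfold mellinInv at hinv
  rw [Complex.real_smul] at hinv
  rw [mul_left_comm]
  push_cast at hinv ⊢
  rw [hinv]
  norm_cast

/-- `∫_0^∞ τ^(2ς-1) e^(-τ-x/τ) dτ`, which is `2 x^ς K_{2ς}(2√x)`. -/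
def besselIntegral (ς x : ℝ) : ℝ :=
  ∫ τ in Ioi (0 : ℝ), τ ^ (2 * ς - 1) * Real.exp (-τ) * Real.exp (-(x / τ))

/-- Rescale u = τ/a; the index satisfies 2ς - 1 = i - n. -/
theorem integral_pow_mul_exp_mul_exp_inv {a b : ℝ} (ha : 0 < a) (i n : ℕ) :
    ∫ u in Ioi (0 : ℝ), u ^ i / u ^ n * Real.exp (-(a * u)) * Real.exp (-(b / u)) =
      a ^ ((n : ℝ) - i - 1) * besselIntegral ((-n + i + 1 : ℝ) / 2) (a * b) := by
  have := setIntegral_Ioi_affine (a := 0) (inv_pos.2 ha) 0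
    fun u => u ^ i / u ^ n * Real.exp (-(a * u)) * Real.exp (-(b / u))
  simp only [zero_add, mul_zero] at this
  rw [this]
  unfold besselIntegral
  rw [← integral_const_mul, ← integral_const_mul]
  refine setIntegral_congr_fun measurableSet_Ioi fun τ (hτ : 0 < τ) => ?_
  rw [show 2 * ((-n + i + 1 : ℝ) / 2) - 1 = (i : ℝ) - n by ring, Real.rpow_sub hτ,
    Real.rpow_sub ha, Real.rpow_sub ha, Real.rpow_natCast, Real.rpow_natCast, Real.rpow_natCast,
    Real.rpow_natCast, Real.rpow_one, show a * (a⁻¹ * τ) = τ by field_simp,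
    show b / (a⁻¹ * τ) = a * b / τ by field_simp,
    mul_pow, mul_pow, inv_pow, inv_pow]
  field_simp

theorem meijerLaplace_eq_integral {q ς x : ℝ} (hq : |ς| < q) (hx : 0 < x) :
    IntegrableOn (fun θ => θ ^ (q - ς - 1) * besselIntegral ς (θ * x)) (Ioo 0 1) ∧
    ∫ θ in Ioo (0 : ℝ) 1, θ ^ (q - ς - 1) * besselIntegral ς (θ * x) = meijerLaplace q ς x := by
  have h := integrable_meijerLaplace hq hx
  have hin : ∀ θ : ℝ, ∫ τ in Ioi (0 : ℝ),
      meijerWeight q ς (θ, τ) * Real.exp (-((θ, τ).1 / (θ, τ).2 * x)) =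
      θ ^ (q - ς - 1) * besselIntegral ς (θ * x) := fun θ => by
    unfold besselIntegral meijerWeight
    rw [← integral_const_mul]
    refine integral_congr_ae (Filter.Eventually.of_forall fun τ => ?_)
    simp only
    rw [div_mul_eq_mul_div]
    ring
  have h1 := h.integral_prod_left
  have h2 := integral_prod _ h
  simp only [hin] at h1 h2
  exact ⟨h1, h2.symm⟩

/-- Substitute θ = (v/V)^ν in `meijerLaplace_eq_integral`. Integrability is carried along so that
integrals over (0, b) and (0, a) can be subtracted afterwards. -/
theorem integral_Ioo_rpow_mul_besselIntegral {q ς ν C V : ℝ} (hq : |ς| < q) (hν : 0 < ν)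
    (hC : 0 < C) (hV : 0 < V) :
    IntegrableOn (fun v => v ^ (ν * (q - ς) - 1) * besselIntegral ς (C * v ^ ν)) (Ioo 0 V) ∧
    ∫ v in Ioo 0 V, v ^ (ν * (q - ς) - 1) * besselIntegral ς (C * v ^ ν) =
      C ^ ς / ν * (V ^ (ν * q) * meijerG2113 (1 - q) ς (-ς) (-q) (C * V ^ ν)) := by
  have hVν : 0 < V ^ ν := by positivity
  have hx : 0 < C * V ^ ν := by positivity
  obtain ⟨h1, h2⟩ := meijerLaplace_eq_integral hq hx
  have himg : (fun v : ℝ => (v / V) ^ ν) '' Ioo 0 V = Ioo 0 1 := by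
    ext θ
    simp only [mem_image, mem_Ioo]
    constructor
    · rintro ⟨v, ⟨hv0, hv1⟩, rfl⟩
      exact ⟨by positivity, Real.rpow_lt_one (by positivity) ((div_lt_one hV).2 hv1) hν⟩
    · rintro ⟨h0, h1⟩
      refine ⟨V * θ ^ ν⁻¹, ⟨by positivity, ?_⟩, ?_⟩
      · have := Real.rpow_lt_one h0.le h1 (inv_pos.2 hν)
        nlinarith
      · rw [mul_div_cancel_left₀ _ hV.ne', ← Real.rpow_mul h0.le, inv_mul_cancel₀ hν.ne',
          Real.rpow_one]
  have hder : ∀ v ∈ Ioo 0 V, HasDerivWithinAt (fun v : ℝ => (v / V) ^ ν)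
      (1 / V * ν * (v / V) ^ (ν - 1)) (Ioo 0 V) v := fun v hv =>
    (((hasDerivAt_id v).div_const V).rpow_const
      (Or.inl (div_pos hv.1 hV).ne')).hasDerivWithinAt
  have hinj : InjOn (fun v : ℝ => (v / V) ^ ν) (Ioo 0 V) := by
    refine StrictMonoOn.injOn fun a ha b hb hab => ?_
    exact Real.rpow_lt_rpow (div_pos ha.1 hV).le (by gcongr) hν
  have hcongr : ∀ v ∈ Ioo 0 V, |1 / V * ν * (v / V) ^ (ν - 1)| •
      (((v / V) ^ ν) ^ (q - ς - 1) * besselIntegral ς ((v / V) ^ ν * (C * V ^ ν))) =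
      ν * (V ^ (ν * (q - ς)))⁻¹ * (v ^ (ν * (q - ς) - 1) * besselIntegral ς (C * v ^ ν)) := by
    intro v hv
    obtain ⟨hv0, hv1⟩ := hv
    have hvV := div_pos hv0 hV
    rw [abs_of_pos (by positivity), smul_eq_mul,
      show (v / V) ^ ν * (C * V ^ ν) = C * v ^ ν by
        rw [Real.div_rpow hv0.le hV.le]; field_simp,
      ← Real.rpow_mul hvV.le]
    have e : (v / V) ^ (ν - 1) * (v / V) ^ (ν * (q - ς - 1)) =
        V * (V ^ (ν * (q - ς)))⁻¹ * v ^ (ν * (q - ς) - 1) := by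
      rw [← Real.rpow_add hvV, show ν - 1 + ν * (q - ς - 1) = ν * (q - ς) - 1 by ring,
        Real.div_rpow hv0.le hV.le, Real.rpow_sub_one hV.ne']
      have := Real.rpow_pos_of_pos hV (ν * (q - ς))
      field_simp
    calc _ = 1 / V * ν * ((v / V) ^ (ν - 1) * (v / V) ^ (ν * (q - ς - 1))) *
          besselIntegral ς (C * v ^ ν) := by ring
      _ = _ := by rw [e]; field_simp
  have hne : ν * (V ^ (ν * (q - ς)))⁻¹ ≠ 0 := by positivity
  rw [← himg] at h1 h2
  rw [integrableOn_image_iff_integrableOn_abs_deriv_smul measurableSet_Ioo hder hinj,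
    integrableOn_congr_fun hcongr measurableSet_Ioo] at h1
  rw [integral_image_eq_integral_abs_deriv_smul measurableSet_Ioo hder hinj,
    setIntegral_congr_fun measurableSet_Ioo hcongr, integral_const_mul] at h2
  refine ⟨(integrable_const_mul_iff hne.isUnit _).1 h1, ?_⟩
  rw [meijerG2113_eq hq hx, ← h2]
  have e : V ^ (ν * (q - ς)) = V ^ (ν * q) / (V ^ ν) ^ ς := by
    rw [mul_sub, Real.rpow_sub hV, ← Real.rpow_mul hV.le]
  rw [e, Real.rpow_neg hx.le, Real.mul_rpow hC.le hVν.le]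
  have := Real.rpow_pos_of_pos hC ς
  have := Real.rpow_pos_of_pos hVν ς
  have := Real.rpow_pos_of_pos hV (ν * q)
  field_simp

theorem integral_Icc_rpow_mul_besselIntegral {q ς ν C a b : ℝ} (hq : |ς| < q) (hν : 0 < ν)
    (hC : 0 < C) (ha : 0 < a) (hab : a ≤ b) :
    ∫ v in Icc a b, v ^ (ν * (q - ς) - 1) * besselIntegral ς (C * v ^ ν) =
      C ^ ς / ν * (b ^ (ν * q) * meijerG2113 (1 - q) ς (-ς) (-q) (C * b ^ ν) -
        a ^ (ν * q) * meijerG2113 (1 - q) ς (-ς) (-q) (C * a ^ ν)) := by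
  obtain ⟨i1, e1⟩ := integral_Ioo_rpow_mul_besselIntegral hq hν hC ha
  obtain ⟨i2, e2⟩ := integral_Ioo_rpow_mul_besselIntegral hq hν hC (ha.trans_le hab)
  rw [mul_sub (C ^ ς / ν), ← e1, ← e2, integral_Icc_eq_integral_Ioc]
  rw [← integrableOn_Ioc_iff_integrableOn_Ioo] at i2
  rw [← integral_Ioc_eq_integral_Ioo, ← integral_Ioc_eq_integral_Ioo,
    ← Ioc_union_Ioc_eq_Ioc ha.le hab, setIntegral_union (Ioc_disjoint_Ioc_of_le le_rfl)
      measurableSet_Ioc (i2.mono_set (Ioc_subset_Ioc_right hab))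
      (i2.mono_set (Ioc_subset_Ioc_left ha.le))]
  ring

/-! ### Tails of Gamma laws -/

/-- The derivative telescopes: each new summand cancels the remainder left by the previous ones. -/
theorem hasDerivAt_exp_neg_mul_sum (n : ℕ) (x : ℝ) :
    HasDerivAt (fun x : ℝ => Real.exp (-x) *
      ∑ i ∈ Finset.range (n + 1), x ^ i / (i.factorial : ℝ))
      (-(x ^ n / (n.factorial : ℝ) * Real.exp (-x))) x := by
  induction n with
  | zero => simpa using (hasDerivAt_neg x).exp
  | succ n ih =>
    have h : HasDerivAt (fun x : ℝ => Real.exp (-x) * (x ^ (n + 1) / ((n + 1).factorial : ℝ)))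
        (Real.exp (-x) * -1 * (x ^ (n + 1) / ((n + 1).factorial : ℝ)) + Real.exp (-x) *
          (((n + 1 : ℕ) : ℝ) * x ^ n / ((n + 1).factorial : ℝ))) x :=
      (hasDerivAt_neg x).exp.mul ((hasDerivAt_pow (n + 1) x).div_const _)
    have h2 := ih.add h
    have hf : (n.factorial : ℝ) ≠ 0 := by positivity
    have hfun : (fun x : ℝ => Real.exp (-x) *
        ∑ i ∈ Finset.range (n + 1 + 1), x ^ i / (i.factorial : ℝ)) =
        (fun x : ℝ => Real.exp (-x) * ∑ i ∈ Finset.range (n + 1), x ^ i / (i.factorial : ℝ)) +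
        fun x : ℝ => Real.exp (-x) * (x ^ (n + 1) / ((n + 1).factorial : ℝ)) := by
      ext x
      rw [Pi.add_apply, Finset.sum_range_succ _ (n + 1)]
      ring
    rw [hfun]
    refine h2.congr_deriv ?_
    rw [Nat.factorial_succ]
    push_cast
    field_simp
    ring

theorem integral_Ioi_pow_mul_exp_neg {m : ℝ} (hm : 0 < m) (n : ℕ) {y : ℝ} (hy : 0 ≤ y) :
    IntegrableOn (fun x => x ^ n * Real.exp (-(m * x))) (Ioi y) ∧
    ∫ x in Ioi y, m ^ (n + 1) / (n.factorial : ℝ) * x ^ n * Real.exp (-(m * x)) =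
      Real.exp (-(m * y)) * ∑ i ∈ Finset.range (n + 1), (m * y) ^ i / (i.factorial : ℝ) := by
  have hint : IntegrableOn (fun x => x ^ n * Real.exp (-(m * x))) (Ioi y) := by
    have := integrableOn_rpow_mul_exp_neg_mul (a := n + 1) (b := m) (by positivity) hm
    simp only [add_sub_cancel_right, Real.rpow_natCast] at this
    exact this.mono_set (Ioi_subset_Ioi hy)
  refine ⟨hint, ?_⟩
  have htend : Filter.Tendsto (fun x : ℝ => -(Real.exp (-x) *
      ∑ i ∈ Finset.range (n + 1), x ^ i / (i.factorial : ℝ))) Filter.atTop (nhds 0) := by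
    have : ∀ i ∈ Finset.range (n + 1), Filter.Tendsto
        (fun x : ℝ => x ^ i * Real.exp (-x) / (i.factorial : ℝ)) Filter.atTop (nhds 0) :=
      fun i _ => by simpa using (Real.tendsto_pow_mul_exp_neg_atTop_nhds_zero i).div_const _
    have h := (tendsto_finsetSum _ this).neg
    simp only [Finset.sum_const_zero, neg_zero] at h
    refine h.congr fun x => ?_
    rw [Finset.mul_sum]
    congr 1
    exact Finset.sum_congr rfl fun i _ => by ring
  have hder : ∀ x : ℝ, HasDerivAt (fun x : ℝ => -(Real.exp (-(m * x)) *
      ∑ i ∈ Finset.range (n + 1), (m * x) ^ i / (i.factorial : ℝ)))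
      (m ^ (n + 1) / (n.factorial : ℝ) * x ^ n * Real.exp (-(m * x))) x := fun x => by
    have h1 := (hasDerivAt_exp_neg_mul_sum n (m * x)).neg
    have h2 := h1.comp x ((hasDerivAt_id x).const_mul m)
    refine h2.congr_deriv ?_
    rw [mul_pow]
    ring
  have := integral_Ioi_of_hasDerivAt_of_tendsto (a := y) (hder y).continuousAt.continuousWithinAt
    (fun x _ => hder x) ?_ (htend.comp (Filter.tendsto_id.const_mul_atTop hm))
  · rw [this]
    simp
  · refine (hint.const_mul (m ^ (n + 1) / (n.factorial : ℝ))).congr ?_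
    exact Filter.Eventually.of_forall fun x => by simp only; ring

namespace S2GParams

variable (p : S2GParams)

/-! ### Elementary facts on the parameters -/

/-- `c = m_rd σ_d² γ η / P_th`. -/
def c : ℝ := p.m_rd * p.σd ^ 2 * p.γ * p.η / p.Pth

theorem m_sr_cast_pos : (0 : ℝ) < p.m_sr := Nat.cast_pos.2 p.m_sr_pos

theorem m_rd_cast_pos : (0 : ℝ) < p.m_rd := Nat.cast_pos.2 p.m_rd_pos

theorem c_pos : 0 < p.c := by
  have := p.m_rd_cast_pos
  have := p.σd_pos
  have := p.γ_pos
  have := p.η_pos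
  have := p.Pth_pos
  unfold c
  positivity

theorem χρε_pos : 0 < p.χρε := by
  obtain ⟨h1, -⟩ := p.χ_mem
  obtain ⟨h3, h4⟩ := p.ρ_mem
  obtain ⟨h5, h6⟩ := p.ε_mem
  have h7 : 0 < 1 - p.ρ := by linarith
  refine mul_pos h1 ?_
  rcases p.ρ_ε with h | h
  · have : 0 < 2 * p.ρ / (1 - p.ρ) := by positivity
    linarith
  · have : 0 ≤ 2 * p.ρ / (1 - p.ρ) := by positivity
    linarith

theorem με_pos : 0 < p.με := by
  obtain ⟨h1, -⟩ := p.μ_mem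
  obtain ⟨h5, h6⟩ := p.ε_mem
  have h7 : 0 < 1 - p.ε := by linarith
  have := p.σr_pos
  have := p.σrb_pos
  unfold με
  positivity

theorem B_pos : 0 < p.B := mul_pos (mul_pos p.με_pos p.χρε_pos) p.γ_pos

theorem A_pos (h : p.γ < p.μ') : 0 < p.A := by
  obtain ⟨h1, h2⟩ := p.μ_mem
  unfold μ' at h
  rw [lt_div_iff₀ (by linarith)] at h
  exact mul_pos (mul_pos p.χρε_pos p.η_pos) (by linarith)

theorem A_nonpos (h : p.μ' ≤ p.γ) : p.A ≤ 0 := by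
  obtain ⟨h1, h2⟩ := p.μ_mem
  unfold μ' at h
  rw [div_le_iff₀ (by linarith)] at h
  exact mul_nonpos_of_nonneg_of_nonpos (mul_pos p.χρε_pos p.η_pos).le (by linarith)

theorem α_pos : 0 < p.α := by
  have := p.b_sr_pos
  have := p.m_sr_cast_pos
  have := p.Ω_sr_nonneg
  unfold α
  positivity

theorem δ_nonneg : 0 ≤ p.δ := by
  have := p.b_sr_pos
  have := p.m_sr_cast_pos
  have := p.Ω_sr_nonneg
  unfold δ
  positivity

theorem βbar_pos : 0 < p.βbar := by
  have h1 := p.b_sr_pos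
  have h2 := p.m_sr_cast_pos
  have h3 := p.Ω_sr_nonneg
  have : p.βbar = p.m_sr / (2 * p.b_sr * p.m_sr + p.Ω_sr) := by
    unfold βbar β δ
    have : 2 * p.b_sr * p.m_sr + p.Ω_sr ≠ 0 := by positivity
    field_simp
    ring
  rw [this]
  positivity

/-- The expression is the falling factorial m(m-1)⋯(m-k+1). -/
theorem neg_one_pow_mul_ascPochhammer_nonneg (m k : ℕ) (hk : k ≤ m) :
    0 ≤ (-1 : ℝ) ^ k * (ascPochhammer ℝ k).eval (-(m : ℝ)) := by
  induction k with
  | zero => simp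
  | succ k ih =>
    rw [ascPochhammer_succ_eval, pow_succ]
    have h1 := ih (by omega)
    have h2 : (0 : ℝ) ≤ m - k := by
      rw [sub_nonneg]
      exact_mod_cast (by omega : k ≤ m)
    have := mul_nonneg h1 h2
    linarith

theorem ζ_nonneg {k : ℕ} (hk : k < p.m_sr) : 0 ≤ p.ζ k := by
  have h := neg_one_pow_mul_ascPochhammer_nonneg (p.m_sr - 1) k (by omega)
  rw [Nat.cast_sub p.m_sr_pos, neg_sub, Nat.cast_one] at h
  have := p.δ_nonneg
  unfold ζ
  positivity

theorem w_min_le_w_max : p.w_min ≤ p.w_max := by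
  have := p.w_min_pos
  have := p.w_er_pos
  unfold w_max
  refine Real.le_sqrt_of_sq_le ?_
  have : 0 < 2 * p.w_er * p.w_min := by positivity
  linarith

theorem h₀_le_v_max : p.h₀ ≤ p.v_max := by
  unfold v_max
  refine Real.le_sqrt_of_sq_le ?_
  linarith [sq_nonneg p.l]

theorem v_max_rpow (a : ℝ) : p.v_max ^ a = (p.h₀ ^ 2 + p.l ^ 2) ^ (a / 2) := by
  rw [v_max, Real.sqrt_eq_rpow, ← Real.rpow_mul (by positivity)]
  ring_nf

/-! ### The integrands -/

/-- The domain of integration in `(w, v, u)`, where `u = A X / w² - B`. -/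
def domain (u₀ : ℝ) : Measure (ℝ × ℝ × ℝ) :=
  (volume.restrict (Icc p.w_min p.w_max)).prod
    ((volume.restrict (Icc p.h₀ p.v_max)).prod (volume.restrict (Ioi u₀)))

instance (u₀ : ℝ) : SFinite (p.domain u₀) := by
  unfold domain
  infer_instance

/-- The polynomial part of the `(k, n, k₁)` term, with the decay in `u`. -/
def kernelBase (k n k₁ : ℕ) (y : ℝ × ℝ × ℝ) : ℝ :=
  y.1 ^ (2 * k + 3) * y.2.1 * (p.c * y.2.1 ^ p.ν) ^ n * (p.B ^ (k + n - k₁) / p.A ^ (k + n + 1)) *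
    (y.2.2 ^ k₁ / y.2.2 ^ n) * Real.exp (-(p.βbar * y.1 ^ 2 * (y.2.2 + p.B) / p.A))

/-- The exponent `c v^ν / A`. -/
def expV (y : ℝ × ℝ × ℝ) : ℝ := p.c * y.2.1 ^ p.ν / p.A

/-- The exponent `c v^ν B / (A u)`. -/
def expU (y : ℝ × ℝ × ℝ) : ℝ := p.c * y.2.1 ^ p.ν * p.B / (p.A * y.2.2)

/-- The `(k, n, k₁)` term of the integrand. -/
def kernel (k n k₁ : ℕ) (y : ℝ × ℝ × ℝ) : ℝ :=
  p.kernelBase k n k₁ y * Real.exp (-p.expV y) * Real.exp (-p.expU y)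

theorem measurable_kernelBase (k n k₁ : ℕ) : Measurable (p.kernelBase k n k₁) := by
  unfold kernelBase
  fun_prop

theorem measurable_expV : Measurable p.expV := by
  unfold expV
  fun_prop

theorem measurable_expU : Measurable p.expU := by
  unfold expU
  fun_prop

theorem ae_domain (u₀ : ℝ) : ∀ᵐ y ∂p.domain u₀,
    y.1 ∈ Icc p.w_min p.w_max ∧ y.2.1 ∈ Icc p.h₀ p.v_max ∧ u₀ < y.2.2 := by
  unfold domain
  rw [Measure.prod_restrict, Measure.prod_restrict]
  filter_upwards [ae_restrict_mem (measurableSet_Icc.prod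
    (measurableSet_Icc.prod measurableSet_Ioi))] with y hy
  exact hy

/-- The variables w and v range over bounded intervals, so a bound in u alone is enough. -/
theorem integrable_domain_of_bound {u₀ : ℝ} (hu₀ : 0 ≤ u₀) {f : ℝ × ℝ × ℝ → ℝ}
    (hf : Measurable f) {C a : ℝ} (ha : 0 < a) (i : ℕ)
    (hb : ∀ᵐ y ∂p.domain u₀, ‖f y‖ ≤ C * (y.2.2 ^ i * Real.exp (-(a * y.2.2)))) :
    Integrable f (p.domain u₀) := by
  have h0 : IntegrableOn (fun u : ℝ => u ^ i * Real.exp (-(a * u))) (Ioi u₀) := by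
    have := integrableOn_rpow_mul_exp_neg_mul (a := i + 1) (by positivity) ha
    simp only [add_sub_cancel_right, Real.rpow_natCast] at this
    exact this.mono_set (Ioi_subset_Ioi hu₀)
  have h1 : Integrable (fun y : ℝ × ℝ × ℝ => C * (y.2.2 ^ i * Real.exp (-(a * y.2.2))))
      (p.domain u₀) := by
    refine Integrable.const_mul ?_ C
    unfold domain
    exact Integrable.comp_snd (Integrable.comp_snd h0 _) _
  exact h1.mono' hf.aestronglyMeasurable hb

theorem norm_kernelBase_le {u₀ : ℝ} (hu₀ : 0 ≤ u₀) (hA : 0 < p.A) (k n k₁ : ℕ) :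
    ∀ᵐ y ∂p.domain u₀, ‖p.kernelBase k n k₁ y‖ ≤
      p.w_max ^ (2 * k + 3) * p.v_max * (p.c * p.v_max ^ p.ν) ^ n *
        (p.B ^ (k + n - k₁) / p.A ^ (k + n + 1)) *
        (y.2.2 ^ k₁ / y.2.2 ^ n) * Real.exp (-(p.βbar * p.w_min ^ 2 / p.A * y.2.2)) := by
  filter_upwards [p.ae_domain u₀] with y ⟨⟨hw1, hw2⟩, ⟨hv1, hv2⟩, hu⟩
  have hw := p.w_min_pos.trans_le hw1
  have hv := p.h₀_pos.trans_le hv1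
  have hu := hu₀.trans_lt hu
  have hB := p.B_pos
  have hc := p.c_pos
  have hβ := p.βbar_pos
  have := p.w_min_pos
  have hν := p.ν_pos
  unfold kernelBase
  rw [Real.norm_of_nonneg (by positivity)]
  have hvm : y.2.1 ^ p.ν ≤ p.v_max ^ p.ν := by gcongr
  have he : p.βbar * p.w_min ^ 2 / p.A * y.2.2 ≤ p.βbar * y.1 ^ 2 * (y.2.2 + p.B) / p.A := by
    rw [div_mul_eq_mul_div]
    gcongr
    linarith
  have hvm0 : 0 < p.v_max := hv.trans_le hv2
  have hwm0 : 0 < p.w_max := hw.trans_le hw2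
  gcongr

/-- When u may reach 0, the singularity u^(-n) is absorbed by the factor e^(-b/u), where b > 0 comes
from v ≥ h₀. Hence this exponential must stay unexpanded for a low threshold. -/
theorem integrable_kernelBase_mul_exp {u₀ : ℝ} (hu₀ : 0 ≤ u₀) (hA : 0 < p.A) (k n k₁ : ℕ) :
    Integrable (fun y => p.kernelBase k n k₁ y * Real.exp (-p.expU y)) (p.domain u₀) := by
  have hB := p.B_pos
  have hc := p.c_pos
  have hβ := p.βbar_pos
  have hwm := p.w_min_pos
  have hν := p.ν_pos
  have hh := p.h₀_pos
  have hvm0 : 0 < p.v_max := hh.trans_le p.h₀_le_v_max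
  have hwm0 : 0 < p.w_max := hwm.trans_le p.w_min_le_w_max
  set b := p.c * p.h₀ ^ p.ν * p.B / p.A with hb
  have hb0 : 0 < b := by positivity
  refine p.integrable_domain_of_bound hu₀ ((p.measurable_kernelBase k n k₁).mul
    p.measurable_expU.neg.exp) (C := p.w_max ^ (2 * k + 3) * p.v_max *
      (p.c * p.v_max ^ p.ν) ^ n * (p.B ^ (k + n - k₁) / p.A ^ (k + n + 1)) *
      ((n.factorial : ℝ) / b ^ n)) (a := p.βbar * p.w_min ^ 2 / p.A) (by positivity) k₁ ?_
  filter_upwards [p.ae_domain u₀, p.norm_kernelBase_le hu₀ hA k n k₁]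
    with y ⟨⟨hw1, hw2⟩, ⟨hv1, hv2⟩, hu⟩ hy
  have hw := p.w_min_pos.trans_le hw1
  have hv := p.h₀_pos.trans_le hv1
  have hu := hu₀.trans_lt hu
  have h1 : b / y.2.2 ≤ p.expU y := by
    unfold expU
    rw [hb, div_div]
    gcongr
  have h2 := Real.pow_div_factorial_le_exp (b / y.2.2) (by positivity) n
  -- From e^t ≥ t^n/n! at t = b/u.
  have h3 : Real.exp (-p.expU y) / y.2.2 ^ n ≤ (n.factorial : ℝ) / b ^ n := by
    have h4 : Real.exp (-p.expU y) ≤ (Real.exp (b / y.2.2))⁻¹ := by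
      rw [← Real.exp_neg]; gcongr
    calc _ ≤ (Real.exp (b / y.2.2))⁻¹ / y.2.2 ^ n := by gcongr
      _ ≤ ((b / y.2.2) ^ n / (n.factorial : ℝ))⁻¹ / y.2.2 ^ n := by gcongr
      _ = _ := by rw [div_pow]; field_simp
  rw [norm_mul, Real.norm_of_nonneg (Real.exp_pos _).le]
  refine (mul_le_mul_of_nonneg_right hy (Real.exp_pos _).le).trans ?_
  calc _ = p.w_max ^ (2 * k + 3) * p.v_max *
      (p.c * p.v_max ^ p.ν) ^ n * (p.B ^ (k + n - k₁) / p.A ^ (k + n + 1)) *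
      (Real.exp (-p.expU y) / y.2.2 ^ n) *
      (y.2.2 ^ k₁ * Real.exp (-(p.βbar * p.w_min ^ 2 / p.A * y.2.2))) := by ring
    _ ≤ _ := by gcongr

/-- For u > u₀ > 0 the factor u^(-n) is at most u₀^(-n), and no exponential in 1/u is needed. -/
theorem integrable_kernelBase {u₀ : ℝ} (hu₀ : 0 < u₀) (hA : 0 < p.A) (k n k₁ : ℕ) :
    Integrable (p.kernelBase k n k₁) (p.domain u₀) := by
  have hB := p.B_pos
  have hc := p.c_pos
  have hβ := p.βbar_pos
  have hwm := p.w_min_pos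
  have hvm0 : 0 < p.v_max := p.h₀_pos.trans_le p.h₀_le_v_max
  have hwm0 : 0 < p.w_max := hwm.trans_le p.w_min_le_w_max
  refine p.integrable_domain_of_bound hu₀.le (p.measurable_kernelBase k n k₁)
    (C := p.w_max ^ (2 * k + 3) * p.v_max *
      (p.c * p.v_max ^ p.ν) ^ n * (p.B ^ (k + n - k₁) / p.A ^ (k + n + 1)) *
      (u₀ ^ n)⁻¹) (a := p.βbar * p.w_min ^ 2 / p.A) (by positivity) k₁ ?_
  filter_upwards [p.ae_domain u₀, p.norm_kernelBase_le hu₀.le hA k n k₁] with y ⟨_, _, hu⟩ hy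
  have hu' := hu₀.trans hu
  refine hy.trans ?_
  calc _ = p.w_max ^ (2 * k + 3) * p.v_max *
      (p.c * p.v_max ^ p.ν) ^ n * (p.B ^ (k + n - k₁) / p.A ^ (k + n + 1)) * (y.2.2 ^ n)⁻¹ *
      (y.2.2 ^ k₁ * Real.exp (-(p.βbar * p.w_min ^ 2 / p.A * y.2.2))) := by ring
    _ ≤ _ := by gcongr

theorem integrable_kernel {u₀ : ℝ} (hu₀ : 0 ≤ u₀) (hA : 0 < p.A) (k n k₁ : ℕ) :
    Integrable (p.kernel k n k₁) (p.domain u₀) := by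
  have h := (p.integrable_kernelBase_mul_exp hu₀ hA k n k₁).mul_bdd (c := 1)
    (g := fun y => Real.exp (-p.expV y)) p.measurable_expV.neg.exp.aestronglyMeasurable ?_
  · refine h.congr (Filter.Eventually.of_forall fun y => ?_)
    unfold kernel
    ring
  · filter_upwards [p.ae_domain u₀] with y ⟨_, ⟨hv1, _⟩, _⟩
    have hv := p.h₀_pos.trans_le hv1
    have hc := p.c_pos
    rw [Real.norm_of_nonneg (Real.exp_pos _).le, Real.exp_le_one_iff, neg_nonpos]
    unfold expV
    positivity

/-! ### The coverage probability as an integral -/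

/-- Numerator minus γ times denominator is a positive multiple of Y(As - B) - K v^ν s with K > 0.
Its positivity forces As - B > 0, and one may then divide. -/
theorem lt_snr₂_iff {X Y w v : ℝ} (hX : 0 < X) (hY : 0 < Y) (hw : 0 < w) (hv : 0 < v) :
    p.γ < p.snr₂ X Y w v ↔
      0 < p.A * (X / w ^ 2) - p.B ∧
        p.γ * p.σd ^ 2 * p.η / p.Pth * v ^ p.ν * (X / w ^ 2) / (p.A * (X / w ^ 2) - p.B) < Y := by
  have hχ := p.χρε_pos
  have hμε := p.με_pos
  have hσ := p.σd_pos
  have hη := p.η_pos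
  have hP := p.Pth_pos
  have hγ := p.γ_pos
  obtain ⟨hμ0, hμ1⟩ := p.μ_mem
  have hμ1' : 0 < 1 - p.μ := by linarith
  set s := X / w ^ 2 with hs
  have hs0 : 0 < s := by positivity
  set T := v ^ p.ν with hT
  have hT0 : 0 < T := by positivity
  have hD : 0 < p.με * p.χρε * p.Pth * Y * v ^ (-p.ν) +
      (1 - p.μ) * p.χρε * p.η * p.Pth * X * w ^ (-2 : ℝ) * Y * v ^ (-p.ν) +
      p.η * X * w ^ (-2 : ℝ) * p.σd ^ 2 := by positivity
  unfold snr₂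
  rw [lt_div_iff₀ hD]
  have hw2 : w ^ (-2 : ℝ) = (w ^ 2)⁻¹ := by
    rw [Real.rpow_neg hw.le]; norm_cast
  have hv2 : v ^ (-p.ν) = T⁻¹ := Real.rpow_neg hv.le _
  have hXs : X * (w ^ 2)⁻¹ = s := by rw [hs, div_eq_mul_inv]
  have key : p.μ * p.χρε * p.Pth * p.η * X * w ^ (-2 : ℝ) * Y * v ^ (-p.ν) -
      p.γ * (p.με * p.χρε * p.Pth * Y * v ^ (-p.ν) +
      (1 - p.μ) * p.χρε * p.η * p.Pth * X * w ^ (-2 : ℝ) * Y * v ^ (-p.ν) +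
      p.η * X * w ^ (-2 : ℝ) * p.σd ^ 2) =
      p.Pth * T⁻¹ * (Y * (p.A * s - p.B) - p.γ * p.σd ^ 2 * p.η / p.Pth * T * s) := by
    rw [hw2, hv2, ← hXs]
    unfold A B
    field_simp
    ring
  have hc : 0 < p.Pth * T⁻¹ := by positivity
  rw [← sub_pos, key, mul_pos_iff_of_pos_left hc, sub_pos]
  have h0 : 0 < p.γ * p.σd ^ 2 * p.η / p.Pth * T * s := by positivity
  constructor
  · intro h
    have h1 : 0 < p.A * s - p.B := pos_of_mul_pos_right (h0.trans h) hY.le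
    exact ⟨h1, (div_lt_iff₀ h1).2 h⟩
  · rintro ⟨h1, h2⟩
    exact (div_lt_iff₀ h1).1 h2

/-- Tail of the Gamma law of shape `m_rd`. -/
def tail (z : ℝ) : ℝ := Real.exp (-z) * ∑ n ∈ Finset.range p.m_rd, z ^ n / (n.factorial : ℝ)

theorem tail_nonneg {z : ℝ} (hz : 0 ≤ z) : 0 ≤ p.tail z := by
  unfold tail
  positivity

theorem lintegral_pdfGrd_Ioi {y : ℝ} (hy : 0 ≤ y) :
    ∫⁻ x in Ioi y, ENNReal.ofReal (p.pdfGrd x) = ENNReal.ofReal (p.tail (p.m_rd * y)) := by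
  obtain ⟨n, hn⟩ : ∃ n, p.m_rd = n + 1 := ⟨p.m_rd - 1, by have := p.m_rd_pos; omega⟩
  obtain ⟨h1, h2⟩ := integral_Ioi_pow_mul_exp_neg p.m_rd_cast_pos n hy
  have hpdf : ∀ x, p.pdfGrd x =
      (p.m_rd : ℝ) ^ (n + 1) / (n.factorial : ℝ) * x ^ n * Real.exp (-(p.m_rd * x)) := fun x => by
    unfold pdfGrd
    have : Real.Gamma p.m_rd = (n.factorial : ℝ) := by
      rw [hn]
      push_cast
      exact Real.Gamma_nat_eq_factorial n
    rw [this, hn]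
    rfl
  rw [← ofReal_integral_eq_lintegral_ofReal]
  · simp only [hpdf, h2]
    unfold tail
    rw [hn]
  · refine (h1.const_mul ((p.m_rd : ℝ) ^ (n + 1) / (n.factorial : ℝ))).congr
      (Filter.Eventually.of_forall fun x => ?_)
    rw [hpdf]
    ring
  · filter_upwards [ae_restrict_mem measurableSet_Ioi] with x hx
    have : 0 < x := hy.trans_lt hx
    rw [hpdf]
    positivity

theorem measurable_pdfGsr : Measurable p.pdfGsr := by
  unfold pdfGsr
  fun_prop

theorem measurable_pdfWsr : Measurable p.pdfWsr := by
  unfold pdfWsr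
  fun_prop

theorem measurable_pdfWrd : Measurable p.pdfWrd := by
  unfold pdfWrd
  fun_prop

variable {p} {Ω : Type*} [MeasurableSpace Ω] {P : Measure Ω} [IsProbabilityMeasure P]
  {g_sr g_rd : Ω → ℂ} {w_sr w_rd : Ω → ℝ}

/-- The variable |g_rd|² is placed last, so that the probability conditional on the other three is
the measure of a section. -/
theorem IsModel.map_eq_prod (h : p.IsModel P g_sr g_rd w_sr w_rd) :
    P.map (fun ω => ((w_sr ω, w_rd ω, ‖g_sr ω‖ ^ 2), ‖g_rd ω‖ ^ 2)) =
      ((P.map w_sr).prod ((P.map w_rd).prod (P.map fun ω => ‖g_sr ω‖ ^ 2))).prod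
        (P.map fun ω => ‖g_rd ω‖ ^ 2) := by
  have m1 : Measurable (fun ω => ‖g_sr ω‖ ^ 2) := h.measurable_g_sr.norm.pow_const 2
  have m2 : Measurable (fun ω => ‖g_rd ω‖ ^ 2) := h.measurable_g_rd.norm.pow_const 2
  have m3 := h.measurable_w_sr
  have m4 := h.measurable_w_rd
  have hm : ∀ i, Measurable ((![fun ω => ‖g_sr ω‖ ^ 2, fun ω => ‖g_rd ω‖ ^ 2, w_sr, w_rd] :
      Fin 4 → Ω → ℝ) i) := by
    intro i
    fin_cases i
    exacts [m1, m2, m3, m4]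
  have i1 : IndepFun w_rd (fun ω => ‖g_sr ω‖ ^ 2) P :=
    h.indep.indepFun (i := 3) (j := 0) (by decide)
  have i2 : IndepFun w_sr (fun ω => (w_rd ω, ‖g_sr ω‖ ^ 2)) P :=
    (h.indep.indepFun_prodMk hm 3 0 2 (by decide) (by decide)).symm
  have i3 : IndepFun (fun ω => (w_sr ω, w_rd ω, ‖g_sr ω‖ ^ 2)) (fun ω => ‖g_rd ω‖ ^ 2) P := by
    have := h.indep.indepFun_finset {0, 2, 3} {1} (by decide) hm
    exact this.comp (φ := fun g : (({0, 2, 3} : Finset (Fin 4)) → ℝ) =>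
      (g ⟨2, by decide⟩, g ⟨3, by decide⟩, g ⟨0, by decide⟩))
      (ψ := fun g : (({1} : Finset (Fin 4)) → ℝ) => g ⟨1, by decide⟩)
      (by fun_prop) (by fun_prop)
  rw [(indepFun_iff_map_prod_eq_prod_map_map (by fun_prop) m2.aemeasurable).1 i3,
    (indepFun_iff_map_prod_eq_prod_map_map (by fun_prop) (by fun_prop)).1 i2,
    (indepFun_iff_map_prod_eq_prod_map_map (by fun_prop) m1.aemeasurable).1 i1]

-- For fixed (w, v, X) the section of the event in Y > 0 is a half-line, of mass `tail`, or empty.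
open Classical in
theorem IsModel.measure_eq_lintegral (h : p.IsModel P g_sr g_rd w_sr w_rd) :
    P {ω | p.γ < p.snr₂ (‖g_sr ω‖ ^ 2) (‖g_rd ω‖ ^ 2) (w_sr ω) (w_rd ω) ∧
      p.Pth < p.η * ‖g_sr ω‖ ^ 2 * (w_sr ω) ^ (-2 : ℝ)} =
    ∫⁻ z, ENNReal.ofReal (p.pdfWsr z.1) * (ENNReal.ofReal (p.pdfWrd z.2.1) *
        ENNReal.ofReal (p.pdfGsr z.2.2)) *
      (if 0 < p.A * (z.2.2 / z.1 ^ 2) - p.B ∧ p.Pth < p.η * (z.2.2 / z.1 ^ 2) then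
        ENNReal.ofReal (p.tail (p.c * z.2.1 ^ p.ν * (z.2.2 / z.1 ^ 2) /
          (p.A * (z.2.2 / z.1 ^ 2) - p.B))) else 0)
      ∂((volume.restrict (Icc p.w_min p.w_max)).prod
        ((volume.restrict (Icc p.h₀ p.v_max)).prod (volume.restrict (Ioi 0)))) := by
  have m1 : Measurable (fun ω => ‖g_sr ω‖ ^ 2) := h.measurable_g_sr.norm.pow_const 2
  have m2 : Measurable (fun ω => ‖g_rd ω‖ ^ 2) := h.measurable_g_rd.norm.pow_const 2
  have m3 := h.measurable_w_sr
  have m4 := h.measurable_w_rd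
  have d1 := p.measurable_pdfGsr.ennreal_ofReal
  have d3 := p.measurable_pdfWsr.ennreal_ofReal
  have d4 := p.measurable_pdfWrd.ennreal_ofReal
  have d41 : Measurable fun z : ℝ × ℝ =>
      ENNReal.ofReal (p.pdfWrd z.1) * ENNReal.ofReal (p.pdfGsr z.2) :=
    (d4.comp measurable_fst).mul (d1.comp measurable_snd)
  have d341 : Measurable fun z : ℝ × ℝ × ℝ => ENNReal.ofReal (p.pdfWsr z.1) *
      (ENNReal.ofReal (p.pdfWrd z.2.1) * ENNReal.ofReal (p.pdfGsr z.2.2)) :=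
    (d3.comp measurable_fst).mul (d41.comp measurable_snd)
  set S : Set ((ℝ × ℝ × ℝ) × ℝ) := {z | p.γ < p.snr₂ z.1.2.2 z.2 z.1.1 z.1.2.1 ∧
    p.Pth < p.η * z.1.2.2 * z.1.1 ^ (-2 : ℝ)} with hS
  have hSm : MeasurableSet S := by
    have m5 : MeasurableSet {z : (ℝ × ℝ × ℝ) × ℝ | p.γ < p.snr₂ z.1.2.2 z.2 z.1.1 z.1.2.1} := by
      refine measurableSet_lt measurable_const ?_
      unfold snr₂
      fun_prop
    have m6 : MeasurableSet {z : (ℝ × ℝ × ℝ) × ℝ | p.Pth < p.η * z.1.2.2 * z.1.1 ^ (-2 : ℝ)} :=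
      measurableSet_lt measurable_const (by fun_prop)
    exact m5.inter m6
  have hmap : P.map (fun ω => ((w_sr ω, w_rd ω, ‖g_sr ω‖ ^ 2), ‖g_rd ω‖ ^ 2)) S =
      P ((fun ω => ((w_sr ω, w_rd ω, ‖g_sr ω‖ ^ 2), ‖g_rd ω‖ ^ 2)) ⁻¹' S) :=
    Measure.map_apply (by fun_prop) hSm
  have hpre : (fun ω => ((w_sr ω, w_rd ω, ‖g_sr ω‖ ^ 2), ‖g_rd ω‖ ^ 2)) ⁻¹' S =
      {ω | p.γ < p.snr₂ (‖g_sr ω‖ ^ 2) (‖g_rd ω‖ ^ 2) (w_sr ω) (w_rd ω) ∧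
        p.Pth < p.η * ‖g_sr ω‖ ^ 2 * (w_sr ω) ^ (-2 : ℝ)} := rfl
  have := Measure.isProbabilityMeasure_map (μ := P) m2.aemeasurable
  rw [← hpre, ← hmap, h.map_eq_prod, Measure.prod_apply hSm,
    show P.map w_sr = _ from h.law_w_sr, show P.map w_rd = _ from h.law_w_rd,
    show P.map (fun ω => ‖g_sr ω‖ ^ 2) = _ from h.law_g_sr, prod_withDensity d4 d1,
    prod_withDensity d3 d41, lintegral_withDensity_eq_lintegral_mul _ d341
      (measurable_measure_prodMk_left hSm)]
  refine lintegral_congr_ae ?_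
  rw [Measure.prod_restrict, Measure.prod_restrict]
  filter_upwards [ae_restrict_mem (measurableSet_Icc.prod
    (measurableSet_Icc.prod measurableSet_Ioi))] with z hz
  obtain ⟨⟨hw1, -⟩, ⟨hv1, -⟩, hX : 0 < z.2.2⟩ := hz
  have hw := p.w_min_pos.trans_le hw1
  have hv := p.h₀_pos.trans_le hv1
  simp only [Pi.mul_apply]
  congr 1
  rw [show P.map (fun ω => ‖g_rd ω‖ ^ 2) = _ from h.law_g_rd,
    withDensity_apply _ (measurable_prodMk_left hSm),
    Measure.restrict_restrict (measurable_prodMk_left hSm)]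
  have hw2 : p.η * z.2.2 * z.1 ^ (-2 : ℝ) = p.η * (z.2.2 / z.1 ^ 2) := by
    rw [Real.rpow_neg hw.le]; norm_cast
    rw [mul_assoc, div_eq_mul_inv]
  set s := z.2.2 / z.1 ^ 2 with hs
  have hs0 : 0 < s := by positivity
  split_ifs with hc
  · obtain ⟨hc1, hc2⟩ := hc
    have hγ := p.γ_pos
    have hσ := p.σd_pos
    have hη := p.η_pos
    have hP := p.Pth_pos
    have hset : Prod.mk z ⁻¹' S ∩ Ioi 0 =
        Ioi (p.γ * p.σd ^ 2 * p.η / p.Pth * z.2.1 ^ p.ν * s / (p.A * s - p.B)) := by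
      ext Y
      simp only [hS, mem_inter_iff, mem_preimage, mem_ofPred_eq, mem_Ioi]
      constructor
      · rintro ⟨⟨h1, -⟩, hY⟩
        exact ((p.lt_snr₂_iff hX hY hw hv).1 h1).2
      · intro hY
        have hY0 : 0 < Y := lt_trans (by positivity) hY
        exact ⟨⟨(p.lt_snr₂_iff hX hY0 hw hv).2 ⟨hc1, hY⟩, by rw [hw2]; exact hc2⟩, hY0⟩
    rw [hset, p.lintegral_pdfGrd_Ioi (by positivity)]
    congr 2
    unfold c
    ring
  · have hset : Prod.mk z ⁻¹' S ∩ Ioi 0 = ∅ := by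
      ext Y
      simp only [hS, mem_inter_iff, mem_preimage, mem_ofPred_eq, mem_Ioi, mem_empty_iff_false,
        iff_false]
      rintro ⟨⟨h1, h2⟩, hY⟩
      rw [hw2] at h2
      exact hc ⟨((p.lt_snr₂_iff hX hY hw hv).1 h1).1, h2⟩
    rw [hset]
    simp

theorem IsModel.P₂_eq_zero (h : p.IsModel P g_sr g_rd w_sr w_rd) (hA : p.A ≤ 0) :
    p.P₂ P g_sr g_rd w_sr w_rd = 0 := by
  unfold P₂ Measure.real
  rw [h.measure_eq_lintegral, lintegral_eq_zero_of_ae_eq_zero]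
  · simp
  rw [Measure.prod_restrict, Measure.prod_restrict]
  filter_upwards [ae_restrict_mem (measurableSet_Icc.prod
    (measurableSet_Icc.prod measurableSet_Ioi))] with z hz
  obtain ⟨-, -, hX : 0 < z.2.2⟩ := hz
  have h1 : p.A * (z.2.2 / z.1 ^ 2) ≤ 0 := mul_nonpos_of_nonpos_of_nonneg hA (by positivity)
  have h2 := p.B_pos
  rw [if_neg fun h => by linarith [h.1], mul_zero]
  rfl

/-- The density of the coverage probability in the coordinates `(w, v, u)`. -/
def coverage (p : S2GParams) (y : ℝ × ℝ × ℝ) : ℝ :=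
  p.pdfWsr y.1 * p.pdfWrd y.2.1 * (y.1 ^ 2 / p.A) *
    p.pdfGsr (y.1 ^ 2 * p.B / p.A + y.1 ^ 2 / p.A * y.2.2) *
      p.tail (p.c * y.2.1 ^ p.ν * (y.2.2 + p.B) / (p.A * y.2.2))

/-- The exponent of the tail splits as `expV` + `expU`. The k-th term of the density and the n-th
term of the tail together carry (u+B)^(k+n)/u^n, which the binomial theorem expands. -/
theorem coverage_eq_sum (p : S2GParams) (hA : 0 < p.A) {y : ℝ × ℝ × ℝ} (hu : 0 < y.2.2) :
    p.coverage y = 2 * p.α / (p.l ^ 2 * p.w_er * p.w_min) *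
      ∑ k ∈ Finset.range p.m_sr, p.ζ k *
        ∑ n ∈ Finset.range p.m_rd, 1 / (n.factorial : ℝ) *
          ∑ k₁ ∈ Finset.range (k + n + 1), ((k + n).choose k₁ : ℝ) * p.kernel k n k₁ y := by
  obtain ⟨w, v, u⟩ := y
  simp only at hu
  have hbin : ∀ k n : ℕ,
      ∑ k₁ ∈ Finset.range (k + n + 1), ((k + n).choose k₁ : ℝ) * p.kernel k n k₁ (w, v, u) =
      w ^ (2 * k + 3) * v * (p.c * v ^ p.ν) ^ n * ((u + p.B) ^ (k + n) / p.A ^ (k + n + 1)) /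
        u ^ n * Real.exp (-(p.βbar * w ^ 2 * (u + p.B) / p.A)) *
        Real.exp (-p.expV (w, v, u)) * Real.exp (-p.expU (w, v, u)) := fun k n => by
    rw [add_pow, Finset.sum_div, Finset.mul_sum, Finset.sum_div, Finset.sum_mul, Finset.sum_mul,
      Finset.sum_mul]
    refine Finset.sum_congr rfl fun k₁ _ => ?_
    unfold kernel kernelBase
    ring
  simp only [hbin]
  have hz : p.c * v ^ p.ν * (u + p.B) / (p.A * u) = p.expV (w, v, u) + p.expU (w, v, u) := by
    unfold expV expU
    field_simp
  have hx : w ^ 2 * p.B / p.A + w ^ 2 / p.A * u = w ^ 2 * (u + p.B) / p.A := by ring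
  have hexp : Real.exp (-((p.β - p.δ) * (w ^ 2 * (u + p.B) / p.A))) =
      Real.exp (-(p.βbar * w ^ 2 * (u + p.B) / p.A)) := by
    unfold βbar
    ring_nf
  unfold coverage pdfGsr tail pdfWsr pdfWrd
  simp only [hx, hexp]
  have hE : Real.exp (-(p.c * v ^ p.ν * (u + p.B) / (p.A * u))) =
      Real.exp (-p.expV (w, v, u)) * Real.exp (-p.expU (w, v, u)) := by
    rw [hz, neg_add, Real.exp_add]
  rw [hE]
  generalize Real.exp (-p.expV (w, v, u)) = e₁
  generalize Real.exp (-p.expU (w, v, u)) = e₂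
  generalize Real.exp (-(p.βbar * w ^ 2 * (u + p.B) / p.A)) = e₃
  calc _ = w / (p.w_er * p.w_min) * (2 * v / p.l ^ 2) * (w ^ 2 / p.A) * p.α * (e₁ * e₂) *
        ((∑ k ∈ Finset.range p.m_sr, p.ζ k * (w ^ 2 * (u + p.B) / p.A) ^ k * e₃) *
          ∑ n ∈ Finset.range p.m_rd,
            (p.c * v ^ p.ν * (u + p.B) / (p.A * u)) ^ n / (n.factorial : ℝ)) := by ring
    _ = _ := by
      rw [Finset.sum_mul_sum]
      simp only [Finset.mul_sum]
      refine Finset.sum_congr rfl fun k _ => Finset.sum_congr rfl fun n _ => ?_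
      have := p.w_er_pos
      have := p.w_min_pos
      have := p.l_pos
      rw [div_pow, div_pow, mul_pow, mul_pow, mul_pow _ u]
      field_simp
      ring

theorem coverage_nonneg (p : S2GParams) (hA : 0 < p.A) {y : ℝ × ℝ × ℝ} (hw : 0 < y.1)
    (hv : 0 < y.2.1) (hu : 0 < y.2.2) : 0 ≤ p.coverage y := by
  have := p.c_pos
  have := p.B_pos
  have := p.w_er_pos
  have := p.w_min_pos
  have := p.α_pos
  unfold coverage
  refine mul_nonneg (mul_nonneg ?_ ?_) (p.tail_nonneg (by positivity))
  · unfold pdfWsr pdfWrd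
    positivity
  · unfold pdfGsr
    refine mul_nonneg p.α_pos.le (Finset.sum_nonneg fun k hk => ?_)
    have := p.ζ_nonneg (Finset.mem_range.1 hk)
    positivity

/-- For fixed w and v, substitute X = w²(u+B)/A, with Jacobian w²/A. The conditions u > 0 and ηs >
P_th merge into u > max(0, P_{A,B}). -/
theorem IsModel.measure_eq_lintegral_coverage (h : p.IsModel P g_sr g_rd w_sr w_rd)
    (hA : 0 < p.A) :
    P {ω | p.γ < p.snr₂ (‖g_sr ω‖ ^ 2) (‖g_rd ω‖ ^ 2) (w_sr ω) (w_rd ω) ∧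
      p.Pth < p.η * ‖g_sr ω‖ ^ 2 * (w_sr ω) ^ (-2 : ℝ)} =
    ∫⁻ y, ENNReal.ofReal (p.coverage y) ∂p.domain (max 0 p.PAB) := by
  have hm1 : Measurable fun y => ENNReal.ofReal (p.coverage y) := by
    unfold coverage pdfWsr pdfWrd pdfGsr tail
    fun_prop
  have hm2 : Measurable fun z : ℝ × ℝ × ℝ => ENNReal.ofReal (p.pdfWsr z.1) *
      (ENNReal.ofReal (p.pdfWrd z.2.1) * ENNReal.ofReal (p.pdfGsr z.2.2)) *
      (if 0 < p.A * (z.2.2 / z.1 ^ 2) - p.B ∧ p.Pth < p.η * (z.2.2 / z.1 ^ 2) then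
        ENNReal.ofReal (p.tail (p.c * z.2.1 ^ p.ν * (z.2.2 / z.1 ^ 2) /
          (p.A * (z.2.2 / z.1 ^ 2) - p.B))) else 0) := by
    refine Measurable.mul ?_ (Measurable.ite ?_ ?_ measurable_const)
    · unfold pdfWsr pdfWrd pdfGsr
      fun_prop
    · have m5 : MeasurableSet {z : ℝ × ℝ × ℝ | 0 < p.A * (z.2.2 / z.1 ^ 2) - p.B} :=
        measurableSet_lt measurable_const (by fun_prop)
      have m6 : MeasurableSet {z : ℝ × ℝ × ℝ | p.Pth < p.η * (z.2.2 / z.1 ^ 2)} :=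
        measurableSet_lt measurable_const (by fun_prop)
      exact m5.inter m6
    · unfold tail
      fun_prop
  have hη := p.η_pos
  have hB := p.B_pos
  rw [h.measure_eq_lintegral, lintegral_prod _ hm2.aemeasurable]
  unfold domain
  rw [lintegral_prod _ hm1.aemeasurable]
  refine setLIntegral_congr_fun measurableSet_Icc fun w hw => ?_
  have hw := p.w_min_pos.trans_le hw.1
  have hm1' := hm1.comp (measurable_prodMk_left (x := w))
  have hm2' := hm2.comp (measurable_prodMk_left (x := w))
  simp only [Function.comp_def] at hm1' hm2' ⊢
  rw [lintegral_prod _ hm1'.aemeasurable, lintegral_prod _ hm2'.aemeasurable]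
  refine setLIntegral_congr_fun measurableSet_Icc fun v hv => ?_
  have hv := p.h₀_pos.trans_le hv.1
  have hb : 0 < w ^ 2 / p.A := by positivity
  have hiff : ∀ x : ℝ, (0 < p.A * (x / w ^ 2) - p.B ∧ p.Pth < p.η * (x / w ^ 2)) ↔
      x ∈ Ioi (w ^ 2 * p.B / p.A + w ^ 2 / p.A * max 0 p.PAB) := fun x => by
    have e1 : w ^ 2 * p.B / p.A + w ^ 2 / p.A * max 0 p.PAB =
        w ^ 2 / p.A * (p.B + max 0 p.PAB) := by ring
    have e2 : w ^ 2 / p.A * (p.B + max 0 p.PAB) < x ↔ max 0 p.PAB < p.A * (x / w ^ 2) - p.B := by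
      rw [← lt_div_iff₀' hb, lt_sub_iff_add_lt', show x / (w ^ 2 / p.A) = p.A * (x / w ^ 2) by
        field_simp]
    rw [mem_Ioi, e1, e2, max_lt_iff]
    refine and_congr_right fun _ => ?_
    unfold PAB
    rw [sub_lt_sub_iff_right, div_lt_iff₀ hη, show p.A * (x / w ^ 2) * p.η =
      p.η * (x / w ^ 2) * p.A by ring, mul_lt_mul_iff_left₀ hA]
  have hind : ∀ x : ℝ, ENNReal.ofReal (p.pdfWsr w) *
      (ENNReal.ofReal (p.pdfWrd v) * ENNReal.ofReal (p.pdfGsr x)) *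
      (if 0 < p.A * (x / w ^ 2) - p.B ∧ p.Pth < p.η * (x / w ^ 2) then
        ENNReal.ofReal (p.tail (p.c * v ^ p.ν * (x / w ^ 2) / (p.A * (x / w ^ 2) - p.B))) else 0) =
      (Ioi (w ^ 2 * p.B / p.A + w ^ 2 / p.A * max 0 p.PAB)).indicator
        (fun x => ENNReal.ofReal (p.pdfWsr w) *
          (ENNReal.ofReal (p.pdfWrd v) * ENNReal.ofReal (p.pdfGsr x)) *
          ENNReal.ofReal (p.tail
            (p.c * v ^ p.ν * (x / w ^ 2) / (p.A * (x / w ^ 2) - p.B)))) x := fun x => by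
    rw [indicator_apply]
    simp only [hiff, mul_ite, mul_zero]
  have hu₀ : 0 ≤ max 0 p.PAB := le_max_left _ _
  simp only [hind]
  rw [lintegral_indicator measurableSet_Ioi, Measure.restrict_restrict measurableSet_Ioi,
    inter_eq_left.2 (Ioi_subset_Ioi (by positivity)), setLIntegral_Ioi_affine hb]
  refine setLIntegral_congr_fun measurableSet_Ioi fun u hu => ?_
  have hu : 0 < u := hu₀.trans_lt hu
  have e1 : (w ^ 2 * p.B / p.A + w ^ 2 / p.A * u) / w ^ 2 = (u + p.B) / p.A := by
    field_simp
    ring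
  have e2 : p.A * ((u + p.B) / p.A) - p.B = u := by
    field_simp
    ring
  have e3 : p.c * v ^ p.ν * ((u + p.B) / p.A) / u = p.c * v ^ p.ν * (u + p.B) / (p.A * u) := by
    field_simp
  have := p.w_er_pos
  have := p.w_min_pos
  -- Nonnegativity of each factor allows the product of `ENNReal.ofReal` to be merged.
  have h1 : 0 ≤ p.pdfWsr w := by unfold pdfWsr; positivity
  have h2 : 0 ≤ p.pdfWrd v := by unfold pdfWrd; positivity
  have h3 : 0 ≤ p.pdfGsr (w ^ 2 * p.B / p.A + w ^ 2 / p.A * u) :=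
    mul_nonneg p.α_pos.le (Finset.sum_nonneg fun k hk => by
      have := p.ζ_nonneg (Finset.mem_range.1 hk)
      positivity)
  simp only [e1, e2, e3]
  rw [← ENNReal.ofReal_mul h2, ← ENNReal.ofReal_mul h1, ← ENNReal.ofReal_mul (by positivity),
    ← ENNReal.ofReal_mul hb.le]
  congr 1
  unfold coverage
  ring

theorem IsModel.P₂_eq_sum (h : p.IsModel P g_sr g_rd w_sr w_rd) (hA : 0 < p.A) :
    p.P₂ P g_sr g_rd w_sr w_rd = 2 * p.α / (p.l ^ 2 * p.w_er * p.w_min) *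
      ∑ k ∈ Finset.range p.m_sr, p.ζ k *
        ∑ n ∈ Finset.range p.m_rd, 1 / (n.factorial : ℝ) *
          ∑ k₁ ∈ Finset.range (k + n + 1), ((k + n).choose k₁ : ℝ) *
            ∫ y, p.kernel k n k₁ y ∂p.domain (max 0 p.PAB) := by
  have hu₀ : 0 ≤ max 0 p.PAB := le_max_left _ _
  have hint := fun k n k₁ => p.integrable_kernel hu₀ hA k n k₁
  have hsum : ∀ᵐ y ∂p.domain (max 0 p.PAB), p.coverage y =
      2 * p.α / (p.l ^ 2 * p.w_er * p.w_min) * ∑ k ∈ Finset.range p.m_sr, p.ζ k *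
        ∑ n ∈ Finset.range p.m_rd, 1 / (n.factorial : ℝ) *
          ∑ k₁ ∈ Finset.range (k + n + 1), ((k + n).choose k₁ : ℝ) * p.kernel k n k₁ y := by
    filter_upwards [p.ae_domain (max 0 p.PAB)] with y ⟨_, _, hu⟩
    exact p.coverage_eq_sum hA (hu₀.trans_lt hu)
  have i3 := fun k n => integrable_finsetSum (μ := p.domain (max 0 p.PAB))
    (Finset.range (k + n + 1)) fun k₁ _ => (hint k n k₁).const_mul ((k + n).choose k₁ : ℝ)
  have i2 := fun k => integrable_finsetSum (μ := p.domain (max 0 p.PAB))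
    (Finset.range p.m_rd) fun n _ => (i3 k n).const_mul (1 / (n.factorial : ℝ))
  have i1 := integrable_finsetSum (μ := p.domain (max 0 p.PAB))
    (Finset.range p.m_sr) fun k _ => (i2 k).const_mul (p.ζ k)
  have hnn : 0 ≤ᵐ[p.domain (max 0 p.PAB)] p.coverage := by
    filter_upwards [p.ae_domain (max 0 p.PAB)] with y ⟨hw, hv, hu⟩
    exact p.coverage_nonneg hA (p.w_min_pos.trans_le hw.1) (p.h₀_pos.trans_le hv.1)
      (hu₀.trans_lt hu)
  unfold P₂ Measure.real
  rw [h.measure_eq_lintegral_coverage hA, ← integral_eq_lintegral_of_nonneg_ae hnn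
    (((i1.const_mul (2 * p.α / (p.l ^ 2 * p.w_er * p.w_min))).congr
      (hsum.mono fun y hy => hy.symm)).aestronglyMeasurable), integral_congr_ae hsum,
    integral_const_mul, integral_finsetSum _ fun k _ => (i2 k).const_mul (p.ζ k)]
  congr 1
  refine Finset.sum_congr rfl fun k _ => ?_
  rw [integral_const_mul, integral_finsetSum _ fun n _ => (i3 k n).const_mul _]
  congr 1
  refine Finset.sum_congr rfl fun n _ => ?_
  rw [integral_const_mul, integral_finsetSum _ fun k₁ _ => (hint k n k₁).const_mul _]
  congr 1
  refine Finset.sum_congr rfl fun k₁ _ => ?_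
  rw [integral_const_mul]

end S2GParams

namespace S2GParams

variable (p : S2GParams)

/-! ### The case of a high saturation threshold -/

theorem h₀_lt_v_max : p.h₀ < p.v_max := by
  have := p.l_pos
  have := p.h₀_pos
  unfold v_max
  refine Real.lt_sqrt_of_sq_lt ?_
  have : 0 < p.l ^ 2 := by positivity
  linarith

/-- Up to a constant factor it is the integral of a positive function over [h₀, v_max],
nondegenerate since l > 0. -/
theorem deltaGamma_ne_zero (hA : 0 < p.A) (N : ℕ) :
    deltaGamma (N + 2 / p.ν) (p.c * p.h₀ ^ p.ν / p.A) (p.c * p.v_max ^ p.ν / p.A) ≠ 0 := by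
  intro h0
  have hI := integral_mul_rpow_pow_mul_exp p.ν_pos p.c_pos hA p.h₀_pos p.h₀_le_v_max N
  rw [h0, mul_zero, integral_Icc_eq_integral_Ioc,
    ← intervalIntegral.integral_of_le p.h₀_le_v_max] at hI
  refine (intervalIntegral.intervalIntegral_pos_of_pos_on ?_ (fun v hv => ?_)
    p.h₀_lt_v_max).ne' hI
  · refine ContinuousOn.intervalIntegrable_of_Icc p.h₀_le_v_max fun v hv => ?_
    have hv : 0 < v := p.h₀_pos.trans_le hv.1
    have : ContinuousAt (fun v : ℝ => v ^ p.ν) v :=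
      Real.continuousAt_rpow_const v p.ν (Or.inl hv.ne')
    exact ContinuousAt.continuousWithinAt (by fun_prop)
  · have hv : 0 < v := p.h₀_pos.trans hv.1
    have := p.c_pos
    positivity

/-- The coefficient of the `w`-integral in the `k₂`-th term, high threshold. -/
def coeff₂ (k n k₁ k₂ : ℕ) : ℝ :=
  p.B ^ (k + n - k₁) / p.A ^ (k + n + 1) * (p.B / p.A) ^ k₂ *
    (p.A ^ (((n + k₂ : ℕ) : ℝ) + 2 / p.ν) * p.c ^ (-(2 / p.ν)) / p.ν *
      deltaGamma (((n + k₂ : ℕ) : ℝ) + 2 / p.ν)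
        (p.c * p.h₀ ^ p.ν / p.A) (p.c * p.v_max ^ p.ν / p.A)) *
    (p.PAB ^ (-(n - k₁ + k₂ : ℝ) / 2) * (p.βbar / p.A) ^ ((n - k₁ + k₂ : ℝ) / 2 - 1))

/-- Dividing by this coefficient transfers integrability from the inner Fubini integral to
`I₁Integrand`. -/
theorem coeff₂_ne_zero (hA : 0 < p.A) (hP : 0 < p.PAB) (k n k₁ k₂ : ℕ) :
    p.coeff₂ k n k₁ k₂ ≠ 0 := by
  have hB := p.B_pos
  have hc := p.c_pos
  have hβ := p.βbar_pos
  have hν := p.ν_pos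
  have h := p.deltaGamma_ne_zero hA (n + k₂)
  unfold coeff₂
  refine mul_ne_zero (mul_ne_zero (by positivity) (mul_ne_zero (by positivity) h)) (by positivity)

/-- A power of `expU` is a monomial in v^ν and 1/u, so the integrand is a product of a function of v
and one of u. The integral of such a product factors without an integrability hypothesis. -/
theorem integral_kernelBase_mul_expU_pow (hA : 0 < p.A) (hP : 0 < p.PAB) (k n k₁ k₂ : ℕ)
    {w : ℝ} (hw : 0 < w) :
    ∫ z, p.kernelBase k n k₁ (w, z) * Real.exp (-p.expV (w, z)) * p.expU (w, z) ^ k₂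
      ∂((volume.restrict (Icc p.h₀ p.v_max)).prod (volume.restrict (Ioi p.PAB))) =
    p.coeff₂ k n k₁ k₂ * p.I₁Integrand k n k₁ k₂ w := by
  have hβ := p.βbar_pos
  set d : ℝ := n - k₁ + k₂ with hd
  set a : ℝ := p.βbar * w ^ 2 / p.A with ha
  have ha0 : 0 < a := by positivity
  have hsplit : ∀ᵐ z ∂((volume.restrict (Icc p.h₀ p.v_max)).prod (volume.restrict (Ioi p.PAB))),
      p.kernelBase k n k₁ (w, z) * Real.exp (-p.expV (w, z)) * p.expU (w, z) ^ k₂ =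
      (z.1 * (p.c * z.1 ^ p.ν) ^ (n + k₂) * Real.exp (-(p.c * z.1 ^ p.ν / p.A))) *
        (w ^ (2 * k + 3) * Real.exp (-(a * p.B)) *
          (p.B ^ (k + n - k₁) / p.A ^ (k + n + 1) * (p.B / p.A) ^ k₂) *
          (z.2 ^ (-d) * Real.exp (-(a * z.2)))) := by
    rw [Measure.prod_restrict]
    filter_upwards [ae_restrict_mem (measurableSet_Icc.prod measurableSet_Ioi)] with z hz
    have hv : 0 < z.1 := p.h₀_pos.trans_le hz.1.1
    have hu : 0 < z.2 := hP.trans hz.2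
    unfold kernelBase expV expU
    have e1 : Real.exp (-(p.βbar * w ^ 2 * (z.2 + p.B) / p.A)) =
        Real.exp (-(a * p.B)) * Real.exp (-(a * z.2)) := by
      rw [← Real.exp_add, ha]
      ring_nf
    have e2 : z.2 ^ (-d) = z.2 ^ k₁ / z.2 ^ n / z.2 ^ k₂ := by
      rw [hd, show -((n : ℝ) - k₁ + k₂) = (k₁ : ℝ) - n - k₂ by ring, Real.rpow_sub hu,
        Real.rpow_sub hu, Real.rpow_natCast, Real.rpow_natCast, Real.rpow_natCast]
    simp only
    have e3 : (p.c * z.1 ^ p.ν * p.B / (p.A * z.2)) ^ k₂ =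
        (p.c * z.1 ^ p.ν) ^ k₂ * (p.B / p.A) ^ k₂ / z.2 ^ k₂ := by
      rw [← mul_pow, ← div_pow]
      congr 1
      field_simp
    rw [e1, e2, e3, pow_add _ n k₂]
    ring
  rw [integral_congr_ae hsplit, integral_prod_mul
    (fun v => v * (p.c * v ^ p.ν) ^ (n + k₂) * Real.exp (-(p.c * v ^ p.ν / p.A)))
    (fun u => w ^ (2 * k + 3) * Real.exp (-(a * p.B)) *
      (p.B ^ (k + n - k₁) / p.A ^ (k + n + 1) * (p.B / p.A) ^ k₂) *
      (u ^ (-d) * Real.exp (-(a * u)))), integral_const_mul,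
    integral_mul_rpow_pow_mul_exp p.ν_pos p.c_pos hA p.h₀_pos p.h₀_le_v_max,
    integral_Ioi_rpow_neg_mul_exp d ha0 hP]
  -- The parameter a is proportional to w², which shifts the exponent 2k+3 of w by d - 2.
  have e3 : a ^ (d / 2 - 1) = (p.βbar / p.A) ^ (d / 2 - 1) * w ^ (d - 2) := by
    rw [ha, show p.βbar * w ^ 2 / p.A = p.βbar / p.A * w ^ 2 by ring,
      Real.mul_rpow (by positivity) (by positivity), ← Real.rpow_natCast w 2, ← Real.rpow_mul hw.le]
    congr 2
    push_cast
    ring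
  have e4 : w ^ (2 * k + n - k₁ + k₂ + 1 : ℝ) = w ^ (2 * k + 3) * w ^ (d - 2) := by
    rw [← Real.rpow_natCast w, ← Real.rpow_add hw, hd]
    congr 1
    push_cast
    ring
  have e5 : Real.exp (-(p.βbar * w ^ 2 / p.A * (p.B + p.PAB / 2))) =
      Real.exp (-(a * p.B)) * Real.exp (-(a * p.PAB / 2)) := by
    rw [← Real.exp_add, ha]
    ring_nf
  unfold I₁Integrand coeff₂
  rw [e3, e4, e5, ← hd, show (-n + k₁ - k₂ : ℝ) / 2 = -d / 2 by rw [hd]; ring,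
    show p.βbar * w ^ 2 * p.PAB / p.A = a * p.PAB by rw [ha]; ring]
  ring

/-- The bound `hk` makes the truncated difference k+n-k₁ in `coeff₂` agree with the real exponent of
B. -/
theorem Ψ₂Term_eq (hA : 0 < p.A) (hP : 0 < p.PAB) {k n k₁ : ℕ} (hk : k₁ ≤ k + n) (k₂ : ℕ) :
    p.Ψ₂Term k n k₁ k₂ = p.ν * p.c ^ (2 / p.ν) * ((-1) ^ k₂ / (k₂.factorial : ℝ) *
      (p.coeff₂ k n k₁ k₂ * p.I₁ k n k₁ k₂)) := by
  have hB := p.B_pos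
  have hc := p.c_pos
  have hβ := p.βbar_pos
  have hν := p.ν_pos
  have hPth := p.Pth_pos
  unfold Ψ₂Term coeff₂
  have g1 : p.m_rd * p.σd ^ 2 * p.γ * p.η * p.h₀ ^ p.ν / (p.A * p.Pth) =
      p.c * p.h₀ ^ p.ν / p.A := by
    unfold c
    field_simp
  have g2 : p.m_rd * p.σd ^ 2 * p.γ * p.η * (p.h₀ ^ 2 + p.l ^ 2) ^ (p.ν / 2) / (p.A * p.Pth) =
      p.c * p.v_max ^ p.ν / p.A := by
    rw [v_max_rpow]
    unfold c
    field_simp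
  have g3 : p.B ^ (k + n - k₁ + k₂ : ℝ) = p.B ^ (k + n - k₁) * p.B ^ k₂ := by
    rw [← pow_add, ← Real.rpow_natCast]
    congr 1
    push_cast [Nat.cast_sub hk]
    ring
  have g4 : p.A ^ (k + 1 + (n - k₁ + k₂ - 2 : ℝ) / 2 - 2 / p.ν) =
      p.A ^ (k + 1) * p.A ^ ((n - k₁ + k₂ : ℝ) / 2 - 1) / p.A ^ (2 / p.ν) := by
    rw [← Real.rpow_natCast, ← Real.rpow_add hA, ← Real.rpow_sub hA]
    congr 1
    push_cast
    ring
  have g5 : p.A ^ (((n + k₂ : ℕ) : ℝ) + 2 / p.ν) = p.A ^ n * p.A ^ k₂ * p.A ^ (2 / p.ν) := by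
    rw [Real.rpow_add hA, Real.rpow_natCast, pow_add]
  rw [g1, g2, g3, g4, g5, Real.div_rpow hβ.le hA.le, Real.rpow_neg hc.le,
    show (-n + k₁ - k₂ : ℝ) / 2 = -(n - k₁ + k₂ : ℝ) / 2 by ring,
    show ((n + k₂ : ℕ) : ℝ) = n + k₂ by push_cast; ring, div_pow]
  have h1 := Real.rpow_pos_of_pos hA (2 / p.ν)
  have h2 := Real.rpow_pos_of_pos hc (2 / p.ν)
  have h3 := Real.rpow_pos_of_pos hA ((n - k₁ + k₂ : ℝ) / 2 - 1)
  generalize p.A ^ (2 / p.ν) = x1 at *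
  generalize p.c ^ (2 / p.ν) = x2 at *
  generalize p.A ^ ((n - k₁ + k₂ : ℝ) / 2 - 1) = x3 at *
  field_simp
  ring

/-- On u > P_{A,B} > 0 the exponent `expU` is bounded, so its exponential may be expanded under the
integral. -/
theorem hasSum_Ψ₂Term (hA : 0 < p.A) (hP : 0 < p.PAB) {k n k₁ : ℕ} (hk : k₁ ≤ k + n) :
    (∀ k₂, IntervalIntegrable (p.I₁Integrand k n k₁ k₂) volume p.w_min p.w_max) ∧
    HasSum (p.Ψ₂Term k n k₁)
      (p.ν * p.c ^ (2 / p.ν) * ∫ y, p.kernel k n k₁ y ∂p.domain p.PAB) := by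
  have hB := p.B_pos
  have hc := p.c_pos
  have hbase : Integrable (fun y => p.kernelBase k n k₁ y * Real.exp (-p.expV y))
      (p.domain p.PAB) := by
    refine (p.integrable_kernelBase hP hA k n k₁).mul_bdd (c := 1)
      p.measurable_expV.neg.exp.aestronglyMeasurable ?_
    filter_upwards [p.ae_domain p.PAB] with y ⟨_, hv, _⟩
    have hv := p.h₀_pos.trans_le hv.1
    rw [Real.norm_of_nonneg (Real.exp_pos _).le, Real.exp_le_one_iff, neg_nonpos]
    unfold expV
    positivity
  obtain ⟨hint, hsum⟩ := hasSum_integral_mul_exp_neg (h := p.expU)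
    (C := p.c * p.v_max ^ p.ν * p.B / (p.A * p.PAB)) hbase
    p.measurable_expU.aestronglyMeasurable (by
      filter_upwards [p.ae_domain p.PAB] with y ⟨_, hv, hu⟩
      have hv0 := p.h₀_pos.trans_le hv.1
      have hu0 := hP.trans hu
      have hν := p.ν_pos
      have hvm : y.2.1 ^ p.ν ≤ p.v_max ^ p.ν := by
        have := hv.2
        gcongr
      have hvm0 := hv0.trans_le hv.2
      unfold expU
      rw [abs_of_nonneg (by positivity)]
      gcongr)
  have hinner : ∀ k₂, ∀ w ∈ Icc p.w_min p.w_max, ∫ z, p.kernelBase k n k₁ (w, z) *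
      Real.exp (-p.expV (w, z)) * p.expU (w, z) ^ k₂
      ∂((volume.restrict (Icc p.h₀ p.v_max)).prod (volume.restrict (Ioi p.PAB))) =
      p.coeff₂ k n k₁ k₂ * p.I₁Integrand k n k₁ k₂ w := fun k₂ w hw =>
    p.integral_kernelBase_mul_expU_pow hA hP k n k₁ k₂ (p.w_min_pos.trans_le hw.1)
  constructor
  · intro k₂
    rw [intervalIntegrable_iff_integrableOn_Icc_of_le p.w_min_le_w_max]
    have h1 : IntegrableOn (fun w => ∫ z, p.kernelBase k n k₁ (w, z) *
      Real.exp (-p.expV (w, z)) * p.expU (w, z) ^ k₂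
      ∂((volume.restrict (Icc p.h₀ p.v_max)).prod (volume.restrict (Ioi p.PAB))))
      (Icc p.w_min p.w_max) := (hint k₂).integral_prod_left
    rw [integrableOn_congr_fun (hinner k₂) measurableSet_Icc] at h1
    exact (integrable_const_mul_iff (p.coeff₂_ne_zero hA hP k n k₁ k₂).isUnit _).1 h1
  · refine (hsum.mul_left (p.ν * p.c ^ (2 / p.ν))).congr_fun ?_
    intro k₂
    rw [p.Ψ₂Term_eq hA hP hk]
    congr 2
    have h2 := hint k₂
    unfold domain at h2 ⊢
    rw [integral_prod _ h2, setIntegral_congr_fun measurableSet_Icc (hinner k₂),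
      integral_const_mul, I₁, intervalIntegral.integral_of_le p.w_min_le_w_max,
      integral_Icc_eq_integral_Ioc]

/-! ### The case of a low saturation threshold -/

/-- The coefficient of the `w`-integral in the `k₂`-th term, low threshold. -/
def coeff₃ (k n k₁ k₂ : ℕ) : ℝ :=
  p.B ^ (k + n - k₁) / p.A ^ (k + n + 1) * (p.c ^ (n + k₂) / p.A ^ k₂) *
    (p.βbar ^ (-ς₃ n k₁) * (p.c * p.B) ^ ς₃ n k₁ / p.ν)

theorem coeff₃_ne_zero (hA : 0 < p.A) (k n k₁ k₂ : ℕ) : p.coeff₃ k n k₁ k₂ ≠ 0 := by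
  have hB := p.B_pos
  have hc := p.c_pos
  have hβ := p.βbar_pos
  have hν := p.ν_pos
  unfold coeff₃
  positivity

/-- With `expU` in place the integrand does not separate. Integrating over u first leaves the Bessel
integral at a multiple of v^ν, times a power of v. Fubini is the reason for `hint`. -/
theorem integral_kernelBase_mul_expV_pow (hA : 0 < p.A) (k n k₁ k₂ : ℕ) {w : ℝ} (hw : 0 < w)
    (hint : Integrable (fun z => p.kernelBase k n k₁ (w, z) * Real.exp (-p.expU (w, z)) *
      p.expV (w, z) ^ k₂)
      ((volume.restrict (Icc p.h₀ p.v_max)).prod (volume.restrict (Ioi 0)))) :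
    ∫ z, p.kernelBase k n k₁ (w, z) * Real.exp (-p.expU (w, z)) * p.expV (w, z) ^ k₂
      ∂((volume.restrict (Icc p.h₀ p.v_max)).prod (volume.restrict (Ioi 0))) =
    p.coeff₃ k n k₁ k₂ * p.I₂Integrand k n k₁ k₂ w := by
  have hβ := p.βbar_pos
  have hB := p.B_pos
  have hc := p.c_pos
  have hν := p.ν_pos
  have hPth := p.Pth_pos
  set a : ℝ := p.βbar * w ^ 2 / p.A with ha
  have ha0 : 0 < a := by positivity
  set q : ℝ := ς₂ n k₁ k₂ + 2 / p.ν with hq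
  set ς : ℝ := ς₃ n k₁ with hς
  set C : ℝ := a * (p.c * p.B / p.A) with hC
  have hC0 : 0 < C := by positivity
  -- In fact q - ς = n + k₂ + 2/ν and q + ς = k₁ + k₂ + 1 + 2/ν.
  have hςq : |ς| < q := by
    have : 0 < 2 / p.ν := by positivity
    have h1 : (0 : ℝ) ≤ n := n.cast_nonneg
    have h2 : (0 : ℝ) ≤ k₁ := k₁.cast_nonneg
    have h3 : (0 : ℝ) ≤ k₂ := k₂.cast_nonneg
    rw [abs_lt, hς, hq]
    unfold ς₂ ς₃
    constructor <;> linarith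
  have hqς : p.ν * (q - ς) - 1 = p.ν * ((n + k₂ : ℕ) : ℝ) + 1 := by
    rw [hς, hq]
    unfold ς₂ ς₃
    push_cast
    field_simp
    ring
  have hu : ∀ v ∈ Icc p.h₀ p.v_max, ∫ u in Ioi (0 : ℝ), p.kernelBase k n k₁ (w, v, u) *
      Real.exp (-p.expU (w, v, u)) * p.expV (w, v, u) ^ k₂ =
      w ^ (2 * k + 3) * Real.exp (-(a * p.B)) * (p.B ^ (k + n - k₁) / p.A ^ (k + n + 1)) *
        (p.c ^ (n + k₂) / p.A ^ k₂) * a ^ ((n : ℝ) - k₁ - 1) *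
        (v ^ (p.ν * (q - ς) - 1) * besselIntegral ς (C * v ^ p.ν)) := fun v hv => by
    have hv0 : 0 < v := p.h₀_pos.trans_le hv.1
    have hb : C * v ^ p.ν = a * (p.c * v ^ p.ν * p.B / p.A) := by rw [hC]; ring
    have hvp : v ^ (p.ν * (q - ς) - 1) = (v ^ p.ν) ^ (n + k₂) * v := by
      rw [hqς, Real.rpow_add_one hv0.ne', Real.rpow_mul hv0.le, Real.rpow_natCast]
    have hbes := integral_pow_mul_exp_mul_exp_inv (b := p.c * v ^ p.ν * p.B / p.A) ha0 k₁ n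
    have hfac : ∀ u ∈ Ioi (0 : ℝ), p.kernelBase k n k₁ (w, v, u) *
        Real.exp (-p.expU (w, v, u)) * p.expV (w, v, u) ^ k₂ =
        w ^ (2 * k + 3) * Real.exp (-(a * p.B)) * (p.B ^ (k + n - k₁) / p.A ^ (k + n + 1)) *
        (p.c ^ (n + k₂) / p.A ^ k₂) * ((v ^ p.ν) ^ (n + k₂) * v) *
        (u ^ k₁ / u ^ n * Real.exp (-(a * u)) *
          Real.exp (-(p.c * v ^ p.ν * p.B / p.A / u))) := fun u _ => by
      unfold kernelBase expV expU
      have e1 : Real.exp (-(p.βbar * w ^ 2 * (u + p.B) / p.A)) =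
          Real.exp (-(a * p.B)) * Real.exp (-(a * u)) := by
        rw [← Real.exp_add, ha]
        ring_nf
      simp only
      rw [e1, div_pow, div_div, mul_pow, mul_pow, pow_add, pow_add]
      ring
    rw [setIntegral_congr_fun measurableSet_Ioi hfac, integral_const_mul, hbes, hb, hvp]
    change _ = _ * (_ * besselIntegral ((-n + k₁ + 1 : ℝ) / 2) _)
    ring
  have ew : w ^ (2 * k + n - k₁ + 2 : ℝ) = w ^ (2 * k + 3) * (w ^ 2) ^ (-ς) := by
    rw [← Real.rpow_natCast w, ← Real.rpow_natCast w, ← Real.rpow_mul hw.le, ← Real.rpow_add hw,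
      hς]
    congr 1
    unfold ς₃
    push_cast
    ring
  -- The first exponent equals -2ς, and the powers of A cancel between a and C.
  have ea : a ^ ((n : ℝ) - k₁ - 1) * C ^ ς =
      (w ^ 2) ^ (-ς) * (p.βbar ^ (-ς) * (p.c * p.B) ^ ς) := by
    have e1 : a ^ ((n : ℝ) - k₁ - 1) = (a ^ ς)⁻¹ * a ^ (-ς) := by
      rw [← Real.rpow_neg ha0.le, ← Real.rpow_add ha0, hς]
      congr 1
      unfold ς₃
      ring
    rw [e1, hC, Real.mul_rpow ha0.le (by positivity), Real.div_rpow (by positivity) hA.le, ha,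
      Real.div_rpow (by positivity) hA.le, Real.div_rpow (by positivity) hA.le,
      Real.mul_rpow hβ.le (by positivity), Real.mul_rpow hβ.le (by positivity),
      Real.rpow_neg hA.le]
    have h1 := Real.rpow_pos_of_pos hA ς
    have h2 := Real.rpow_pos_of_pos hβ ς
    have h3 := Real.rpow_pos_of_pos (by positivity : 0 < w ^ 2) ς
    field_simp
  have eC : ∀ T : ℝ, p.m_rd * p.σd ^ 2 * p.η * p.γ * T * p.B * p.βbar * w ^ 2 /
      (p.A ^ 2 * p.Pth) = C * T := fun T => by
    rw [hC, ha]
    unfold c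
    field_simp
  have eq1 : 1 - ς₂ n k₁ k₂ - 2 / p.ν = 1 - q := by rw [hq]; ring
  have eq2 : -ς₂ n k₁ k₂ - 2 / p.ν = -q := by rw [hq]; ring
  have ev : p.v_max ^ (p.ν * q) = (p.h₀ ^ 2 + p.l ^ 2) ^ (p.ν * ς₂ n k₁ k₂ / 2 + 1) := by
    rw [v_max_rpow, hq]
    congr 1
    field_simp
  have eh : p.h₀ ^ (p.ν * q) = p.h₀ ^ (p.ν * ς₂ n k₁ k₂ + 2) := by
    rw [hq]
    congr 1
    field_simp
  have ee : Real.exp (-(p.B * p.βbar * w ^ 2 / p.A)) = Real.exp (-(a * p.B)) := by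
    rw [ha]
    ring_nf
  rw [integral_prod _ hint, setIntegral_congr_fun measurableSet_Icc hu, integral_const_mul,
    integral_Icc_rpow_mul_besselIntegral hςq hν hC0 p.h₀_pos p.h₀_le_v_max]
  unfold I₂Integrand coeff₃
  rw [eC, eC, eq1, eq2, ← ev, ← eh, ee, ew, ← v_max_rpow, ← hς]
  linear_combination (w ^ (2 * k + 3) * Real.exp (-(a * p.B)) *
    (p.B ^ (k + n - k₁) / p.A ^ (k + n + 1)) * (p.c ^ (n + k₂) / p.A ^ k₂) / p.ν *
    (p.v_max ^ (p.ν * q) * meijerG2113 (1 - q) ς (-ς) (-q) (C * p.v_max ^ p.ν) -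
      p.h₀ ^ (p.ν * q) * meijerG2113 (1 - q) ς (-ς) (-q) (C * p.h₀ ^ p.ν))) * ea

theorem Ψ₃Term_eq (hA : 0 < p.A) {k n k₁ : ℕ} (hk : k₁ ≤ k + n) (k₂ : ℕ) :
    p.Ψ₃Term k n k₁ k₂ = p.ν / (n.factorial : ℝ) * ((-1) ^ k₂ / (k₂.factorial : ℝ) *
      (p.coeff₃ k n k₁ k₂ * p.I₂ k n k₁ k₂)) := by
  have hB := p.B_pos
  have hc := p.c_pos
  have hν := p.ν_pos
  have g1 : p.m_rd * p.σd ^ 2 * p.η * p.γ / p.Pth = p.c := by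
    unfold c
    ring
  have g2 : p.B ^ ((2 * k + n - k₁ + 1 : ℝ) / 2) = p.B ^ (k + n - k₁) * p.B ^ ς₃ n k₁ := by
    rw [← Real.rpow_natCast, ← Real.rpow_add hB]
    congr 1
    push_cast [Nat.cast_sub hk]
    unfold ς₃
    ring
  have g3 : p.c ^ ((n + k₁ + 1 : ℝ) / 2 + k₂) = p.c ^ (n + k₂) * p.c ^ ς₃ n k₁ := by
    rw [← Real.rpow_natCast, ← Real.rpow_add hc]
    congr 1
    push_cast
    unfold ς₃
    ring
  have g4 : ((n - k₁ - 1 : ℝ) / 2) = -ς₃ n k₁ := by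
    unfold ς₃
    ring
  unfold Ψ₃Term coeff₃
  rw [g1, g2, g3, g4, Real.mul_rpow hc.le hB.le, pow_add _ _ k₂]
  field_simp

/-- Near u = 0 the exponent `expU` is unbounded, so `expV` is expanded instead; it is bounded
because v ≤ v_max. -/
theorem hasSum_Ψ₃Term (hA : 0 < p.A) {k n k₁ : ℕ} (hk : k₁ ≤ k + n) :
    (∀ k₂, IntervalIntegrable (p.I₂Integrand k n k₁ k₂) volume p.w_min p.w_max) ∧
    HasSum (p.Ψ₃Term k n k₁)
      (p.ν / (n.factorial : ℝ) * ∫ y, p.kernel k n k₁ y ∂p.domain 0) := by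
  have hc := p.c_pos
  obtain ⟨hint, hsum⟩ := hasSum_integral_mul_exp_neg (h := p.expV)
    (C := p.c * p.v_max ^ p.ν / p.A) (p.integrable_kernelBase_mul_exp le_rfl hA k n k₁)
    p.measurable_expV.aestronglyMeasurable (by
      filter_upwards [p.ae_domain 0] with y ⟨_, hv, _⟩
      have hv0 := p.h₀_pos.trans_le hv.1
      have hν := p.ν_pos
      have hvm : y.2.1 ^ p.ν ≤ p.v_max ^ p.ν := by
        have := hv.2
        gcongr
      unfold expV
      rw [abs_of_nonneg (by positivity)]
      gcongr)
  have hinner : ∀ k₂, ∀ᵐ w ∂volume.restrict (Icc p.w_min p.w_max),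
      ∫ z, p.kernelBase k n k₁ (w, z) * Real.exp (-p.expU (w, z)) * p.expV (w, z) ^ k₂
      ∂((volume.restrict (Icc p.h₀ p.v_max)).prod (volume.restrict (Ioi 0))) =
      p.coeff₃ k n k₁ k₂ * p.I₂Integrand k n k₁ k₂ w := fun k₂ => by
    have h2 := hint k₂
    unfold domain at h2
    -- Slices of an integrable function are integrable only for almost every w, so the inner
    -- identity is obtained almost everywhere.
    filter_upwards [h2.prod_right_ae, ae_restrict_mem measurableSet_Icc] with w h3 hw
    exact p.integral_kernelBase_mul_expV_pow hA k n k₁ k₂ (p.w_min_pos.trans_le hw.1) h3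
  constructor
  · intro k₂
    rw [intervalIntegrable_iff_integrableOn_Icc_of_le p.w_min_le_w_max]
    have h1 := (hint k₂).integral_prod_left.congr (hinner k₂)
    exact (integrable_const_mul_iff (p.coeff₃_ne_zero hA k n k₁ k₂).isUnit _).1 h1
  · have hker : ∀ y, p.kernel k n k₁ y =
        p.kernelBase k n k₁ y * Real.exp (-p.expU y) * Real.exp (-p.expV y) := fun y => by
      unfold kernel
      ring
    simp only [hker]
    refine (hsum.mul_left (p.ν / (n.factorial : ℝ))).congr_fun ?_
    intro k₂
    rw [p.Ψ₃Term_eq hA hk]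
    congr 2
    have h2 := hint k₂
    unfold domain at h2 ⊢
    rw [integral_prod _ h2, integral_congr_ae (hinner k₂), integral_const_mul, I₂,
      intervalIntegral.integral_of_le p.w_min_le_w_max, integral_Icc_eq_integral_Ioc]

end S2GParams

end

/-! ### Assembly of the three cases. -/

theorem theorem2 (p : S2GParams) {Ω : Type*} [MeasurableSpace Ω] (P : Measure Ω)
    [IsProbabilityMeasure P] (g_sr g_rd : Ω → ℂ) (w_sr w_rd : Ω → ℝ)
    (hmodel : p.IsModel P g_sr g_rd w_sr w_rd) :
    (p.γ < p.μ' → p.B / p.A * p.η < p.Pth →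
      (∀ k < p.m_sr, ∀ n < p.m_rd, ∀ k₁ ≤ k + n,
        (∀ k₂, IntervalIntegrable (p.I₁Integrand k n k₁ k₂) volume p.w_min p.w_max) ∧
        Summable (p.Ψ₂Term k n k₁)) ∧
      p.P₂ P g_sr g_rd w_sr w_rd = p.Ψ₂) ∧
    (p.γ < p.μ' → p.Pth ≤ p.B / p.A * p.η →
      (∀ k < p.m_sr, ∀ n < p.m_rd, ∀ k₁ ≤ k + n,
        (∀ k₂, IntervalIntegrable (p.I₂Integrand k n k₁ k₂) volume p.w_min p.w_max) ∧
        Summable (p.Ψ₃Term k n k₁)) ∧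
      p.P₂ P g_sr g_rd w_sr w_rd = p.Ψ₃) ∧
    (p.μ' ≤ p.γ → p.P₂ P g_sr g_rd w_sr w_rd = 0) := by
  have hη := p.η_pos
  have hν := p.ν_pos
  have hc := p.c_pos
  refine ⟨fun hγ hth => ?_, fun hγ hth => ?_, fun h => hmodel.P₂_eq_zero (p.A_nonpos h)⟩
  · have hA := p.A_pos hγ
    -- As A and η are positive, P_th > Bη/A is the same as P_{A,B} > 0, and the lower limit max(0,
    -- P_{A,B}) becomes P_{A,B}.
    have hP : 0 < p.PAB := by
      rw [div_mul_eq_mul_div, div_lt_iff₀ hA] at hth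
      unfold S2GParams.PAB
      rw [sub_pos, lt_div_iff₀ hη]
      exact hth
    refine ⟨fun k _ n _ k₁ hk => ⟨(p.hasSum_Ψ₂Term hA hP hk).1,
      (p.hasSum_Ψ₂Term hA hP hk).2.summable⟩, ?_⟩
    have hsum : p.Ψ₂ = 2 * p.α / (p.l ^ 2 * p.w_er * p.w_min * p.ν) * p.c ^ (-(2 / p.ν)) *
        ∑ k ∈ Finset.range p.m_sr, p.ζ k *
          ∑ n ∈ Finset.range p.m_rd, 1 / (n.factorial : ℝ) *
            ∑ k₁ ∈ Finset.range (k + n + 1), ((k + n).choose k₁ : ℝ) *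
              (p.ν * p.c ^ (2 / p.ν) * ∫ y, p.kernel k n k₁ y ∂p.domain p.PAB) := by
      unfold S2GParams.Ψ₂
      congr 1
      refine Finset.sum_congr rfl fun k _ => congrArg _ (Finset.sum_congr rfl fun n _ =>
        congrArg _ (Finset.sum_congr rfl fun k₁ hk₁ => ?_))
      rw [(p.hasSum_Ψ₂Term hA hP (Nat.lt_succ_iff.1 (Finset.mem_range.1 hk₁))).2.tsum_eq]
    rw [hsum, hmodel.P₂_eq_sum hA, max_eq_right hP.le]
    -- The constant ν c^(2/ν), common to all terms, cancels against the prefactor.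
    simp only [mul_left_comm _ (p.ν * p.c ^ (2 / p.ν)), ← Finset.mul_sum]
    rw [Real.rpow_neg hc.le]
    have := Real.rpow_pos_of_pos hc (2 / p.ν)
    field_simp
  · have hA := p.A_pos hγ
    have hP : p.PAB ≤ 0 := by
      rw [div_mul_eq_mul_div, le_div_iff₀ hA] at hth
      unfold S2GParams.PAB
      rw [sub_nonpos, div_le_iff₀ hη]
      exact hth
    refine ⟨fun k _ n _ k₁ hk => ⟨(p.hasSum_Ψ₃Term hA hk).1,
      (p.hasSum_Ψ₃Term hA hk).2.summable⟩, ?_⟩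
    have hsum : p.Ψ₃ = 2 * p.α / (p.l ^ 2 * p.w_er * p.w_min * p.ν) *
        ∑ k ∈ Finset.range p.m_sr, p.ζ k *
          ∑ n ∈ Finset.range p.m_rd,
            ∑ k₁ ∈ Finset.range (k + n + 1), p.ν * (1 / (n.factorial : ℝ) *
              (((k + n).choose k₁ : ℝ) * ∫ y, p.kernel k n k₁ y ∂p.domain 0)) := by
      unfold S2GParams.Ψ₃
      congr 1
      refine Finset.sum_congr rfl fun k _ => congrArg _ (Finset.sum_congr rfl fun n _ =>
        Finset.sum_congr rfl fun k₁ hk₁ => ?_)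
      rw [(p.hasSum_Ψ₃Term hA (Nat.lt_succ_iff.1 (Finset.mem_range.1 hk₁))).2.tsum_eq]
      ring
    rw [hsum, hmodel.P₂_eq_sum hA, max_eq_left hP]
    simp only [← Finset.mul_sum, mul_left_comm _ p.ν]
    field_simp
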